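/- Let $k$ be an algebraically closed field and let $C$ be a finite dimensional $k$-algebra of global dimension at most $2$. Modules are finitely generated right modules, $D=\operatorname{Hom}_k(-,k)$, $\tau$ and $\tau^{-1}$ are the Auslander–Reiten translations, and $\Omega X$ and $\Omega^{-1}X$ are the kernel of a projective cover and the cokernel of an injective envelope of $X$. Let $E$ be the $C$-$C$-bimodule $\operatorname{Ext}^2_C(DC,C)$ and let $B=C\ltimes E$ be the relation extension of $C$, that is, the vector space $C\oplus E$ with multiplication $(c,e)(c',e')=(cc',ce'+ec')$. Every $C$-module $M$ is regarded as a $B$-module by $m\cdot(c,e)=mc$. For a finite dimensional algebra $\Lambda$, a $\Lambda$-module $M$ is called $\tau_\Lambda$-rigid if $\operatorname{Hom}_\Lambda(M,\tau_\Lambda M)=0$. Let $M$ be a $\tau_C$-rigid semisimple $C$-module, let $f\colon P_0\to M$ be a projective cover and let $g\colon M\to I_0$ be an injective envelope in $\operatorname{mod} C$. (a) If $\operatorname{Hom}_C(\tau_C^{-1}\Omega_C^{-1}P_0,M)=0$, then $M$ is $\tau_B$-rigid. (b) If $\operatorname{Hom}_C(M,\tau_C\Omega_C I_0)=0$, then $M$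 is $\tau_B$-rigid. -/

import Mathlib

/-!
Throughout, `k` is a field and `A`, `S` are finite dimensional `k`-algebras.
A right `A`-module is a `Module Aᵐᵒᵖ M`.
-/

open CategoryTheory MulOpposite

universe u

namespace ArtinAlg

/-! ### Projective covers and injective envelopes -/

section Covers

/-- `f : P → M` is a projective cover: `P` is projective, `f` is surjective and the kernel of `f`
is superfluous. -/
def IsProjectiveCover {S P M : Type u} [Ring S] [AddCommGroup P] [Module S P]
    [AddCommGroup M] [Module S M] (f : P →ₗ[S] M) : Prop :=
  Module.Projective S P ∧ Function.Surjective f ∧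
    ∀ N : Submodule S P, N ⊔ LinearMap.ker f = ⊤ → N = ⊤

/-- `g : M → I` is an injective envelope: `I` is injective, `g` is injective and the image of `g`
is essential. -/
def IsInjectiveEnvelope {S M I : Type u} [Ring S] [AddCommGroup M] [Module S M]
    [AddCommGroup I] [Module S I] (g : M →ₗ[S] I) : Prop :=
  Module.Injective S I ∧ Function.Injective g ∧
    ∀ N : Submodule S I, N ⊓ LinearMap.range g = ⊥ → N = ⊥

/-- A finitely generated projective cover of `M`. -/
structure ProjCover (S M : Type u) [Ring S] [AddCommGroup M] [Module S M] where
  P : Type u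
  [grp : AddCommGroup P]
  [mod : Module S P]
  [fin : Module.Finite S P]
  f : P →ₗ[S] M
  isCover : IsProjectiveCover f

attribute [instance] ProjCover.grp ProjCover.mod ProjCover.fin

/-- A finitely generated injective envelope of `M`, with the `k`-vector space structure that
underlies its `S`-module structure. -/
structure InjEnv (k S M : Type u) [Field k] [Ring S] [Algebra k S] [AddCommGroup M]
    [Module S M] where
  I : Type u
  [grp : AddCommGroup I]
  [mod : Module S I]
  [kmod : Module k I]
  [tower : IsScalarTower k S I]
  [fin : Module.Finite S I]
  g : M →ₗ[S] I
  isEnvelope : IsInjectiveEnvelope g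

attribute [instance] InjEnv.grp InjEnv.mod InjEnv.kmod InjEnv.tower InjEnv.fin

/-- Fitting's lemma, in the form needed below. -/
theorem exists_pow_isCompl {S M : Type u} [Ring S] [AddCommGroup M] [Module S M]
    [IsNoetherian S M] [IsArtinian S M] (h : Module.End S M) :
    ∃ n : ℕ, IsCompl (LinearMap.ker (h ^ (n + 1))) (LinearMap.range (h ^ (n + 1))) := by
  obtain ⟨n, hn⟩ := Filter.eventually_atTop.mp h.eventually_isCompl_ker_pow_range_pow
  exact ⟨n, hn _ (Nat.le_succ n)⟩

theorem nonempty_projCover (S M : Type u) [Ring S] [IsArtinianRing S] [AddCommGroup M]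
    [Module S M] [Module.Finite S M] : Nonempty (ProjCover S M) := by
  obtain ⟨n, π, hπ⟩ := Module.Finite.exists_fin' S M
  let F := Fin n → S
  let T : Set (Submodule S F) :=
    {Q | (∃ Q', IsCompl Q Q') ∧ Function.Surjective (π ∘ₗ Q.subtype)}
  have hT : T.Nonempty := by
    refine ⟨⊤, ⟨⊥, isCompl_top_bot⟩, fun m => ?_⟩
    obtain ⟨x, rfl⟩ := hπ m
    exact ⟨⟨x, trivial⟩, rfl⟩
  obtain ⟨Q, ⟨⟨Q', hQ⟩, hs⟩, hmin⟩ := wellFounded_lt.has_min T hT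
  have hproj : Module.Projective S Q :=
    Module.Projective.of_split Q.subtype (Submodule.projectionOnto Q Q' hQ)
      (LinearMap.ext fun x => Submodule.projectionOnto_apply_left hQ x)
  refine ⟨{ P := Q, f := π ∘ₗ Q.subtype, isCover := ⟨hproj, hs, fun N hN => ?_⟩ }⟩
  set p : Q →ₗ[S] M := π ∘ₗ Q.subtype with hp
  have hNs : Function.Surjective (p ∘ₗ N.subtype) := by
    intro m
    obtain ⟨x, rfl⟩ := hs m
    have hx : x ∈ N ⊔ LinearMap.ker p := hN ▸ trivial
    obtain ⟨y, hy, z, hz, rfl⟩ := Submodule.mem_sup.mp hx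
    exact ⟨⟨y, hy⟩, by simp [LinearMap.mem_ker.mp hz]⟩
  obtain ⟨l, hl⟩ := Module.projective_lifting_property (p ∘ₗ N.subtype) p hNs
  let h : Module.End S Q := N.subtype ∘ₗ l
  have hph : ∀ m : ℕ, p ∘ₗ (h ^ m) = p := by
    intro m
    induction m with
    | zero => rfl
    | succ m ih =>
      rw [pow_succ', Module.End.mul_eq_comp, ← LinearMap.comp_assoc]
      have : p ∘ₗ h = p := hl
      rw [this, ih]
  obtain ⟨m, hm⟩ := exists_pow_isCompl h
  set r := LinearMap.range (h ^ (m + 1)) with hr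
  have hrN : r ≤ N := by
    rintro _ ⟨x, rfl⟩
    rw [pow_succ']
    exact (l ((h ^ m) x)).2
  have hrT : r.map Q.subtype ∈ T := by
    refine ⟨⟨(LinearMap.ker (h ^ (m + 1))).map Q.subtype ⊔ Q', ?_⟩, ?_⟩
    · have hsup : r.map Q.subtype ⊔ (LinearMap.ker (h ^ (m + 1))).map Q.subtype = Q := by
        rw [← Submodule.map_sup, hm.symm.sup_eq_top, Submodule.map_subtype_top]
      have hinf : Disjoint (r.map Q.subtype) ((LinearMap.ker (h ^ (m + 1))).map Q.subtype) := by
        rw [disjoint_iff, ← Submodule.map_inf _ Q.injective_subtype, hm.symm.inf_eq_bot,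
          Submodule.map_bot]
      refine ⟨?_, ?_⟩
      · refine hinf.disjoint_sup_right_of_disjoint_sup_left ?_
        rw [hsup]; exact hQ.disjoint
      · rw [codisjoint_iff, ← sup_assoc, hsup, hQ.sup_eq_top]
    · intro y
      obtain ⟨x, rfl⟩ := hs y
      exact ⟨⟨_, Submodule.mem_map_of_mem (LinearMap.mem_range_self (h ^ (m + 1)) x)⟩,
        LinearMap.congr_fun (hph (m + 1)) x⟩
  have hle : r.map Q.subtype ≤ Q := Submodule.map_subtype_le Q r
  have heq : r.map Q.subtype = Q := by
    by_contra hne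
    exact hmin _ hrT (lt_of_le_of_ne hle hne)
  have : r = ⊤ := by
    apply Submodule.map_injective_of_injective Q.injective_subtype
    rw [heq, Submodule.map_subtype_top]
  exact top_le_iff.mp (this ▸ hrN)

end Covers

/-! ### The standard duality `D = Hom_k(-, k)` -/

section Duality

/-- `D N = Hom_k(N, k)`. -/
def D (k N : Type u) [Field k] [AddCommGroup N] [Module k N] : Type u := N →ₗ[k] k

variable (k : Type u) [Field k]

section
variable (N : Type u) [AddCommGroup N] [Module k N]

noncomputable instance : AddCommGroup (D k N) := inferInstanceAs (AddCommGroup (N →ₗ[k] k))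

instance : FunLike (D k N) N k := inferInstanceAs (FunLike (N →ₗ[k] k) N k)

instance : LinearMapClass (D k N) k N k := inferInstanceAs (LinearMapClass (N →ₗ[k] k) k N k)

variable {k N}

@[ext] theorem D.ext {φ ψ : D k N} (h : ∀ x, φ x = ψ x) : φ = ψ := LinearMap.ext h

@[simp] theorem D.add_apply (φ ψ : D k N) (x : N) : (φ + ψ) x = φ x + ψ x := rfl

@[simp] theorem D.zero_apply (x : N) : (0 : D k N) x = 0 := rfl

/-- The dual of a left module is a right module: `(φ s) x = φ (s x)`. -/
noncomputable instance D.rightModule {S : Type u} [Ring S] [Module S N] [SMulCommClass S k N] :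
    Module Sᵐᵒᵖ (D k N) where
  smul s φ := LinearMap.comp (show N →ₗ[k] k from φ) (DistribSMul.toLinearMap k N s.unop)
  one_smul φ := D.ext fun x => congrArg φ (one_smul S x)
  mul_smul s t φ := D.ext fun x => congrArg φ (mul_smul t.unop s.unop x)
  smul_zero _ := rfl
  smul_add _ _ _ := rfl
  add_smul s t φ := D.ext fun x =>
    (congrArg φ (add_smul s.unop t.unop x)).trans (map_add φ _ _)
  zero_smul φ := D.ext fun x => (congrArg φ (zero_smul S x)).trans (map_zero φ)

theorem D.op_smul_apply {S : Type u} [Ring S] [Module S N] [SMulCommClass S k N]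
    (s : Sᵐᵒᵖ) (φ : D k N) (x : N) : (s • φ) x = φ (s.unop • x) := rfl

/-- The dual of a right module is a left module: `(s φ) x = φ (x s)`. -/
noncomputable instance D.leftModule {S : Type u} [Ring S] [Module Sᵐᵒᵖ N] [SMulCommClass Sᵐᵒᵖ k N] :
    Module S (D k N) where
  smul s φ := LinearMap.comp (show N →ₗ[k] k from φ) (DistribSMul.toLinearMap k N (op s))
  one_smul φ := D.ext fun x => congrArg φ (one_smul Sᵐᵒᵖ x)
  mul_smul s t φ := D.ext fun x => congrArg φ (mul_smul (op t) (op s) x)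
  smul_zero _ := rfl
  smul_add _ _ _ := rfl
  add_smul s t φ := D.ext fun x =>
    (congrArg φ (add_smul (op s) (op t) x)).trans (map_add φ _ _)
  zero_smul φ := D.ext fun x => (congrArg φ (zero_smul Sᵐᵒᵖ x)).trans (map_zero φ)

theorem D.smul_apply {S : Type u} [Ring S] [Module Sᵐᵒᵖ N] [SMulCommClass Sᵐᵒᵖ k N]
    (s : S) (φ : D k N) (x : N) : (s • φ) x = φ (op s • x) := rfl

noncomputable instance D.kModule : Module k (D k N) := inferInstanceAs (Module k (N →ₗ[k] k))

theorem D.k_smul_apply (a : k) (φ : D k N) (x : N) : (a • φ) x = a * φ x := rfl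

instance [FiniteDimensional k N] : FiniteDimensional k (D k N) :=
  inferInstanceAs (FiniteDimensional k (N →ₗ[k] k))

end

variable {k}
variable {S : Type u} [Ring S] [Algebra k S] {N : Type u} [AddCommGroup N] [Module k N]

instance [Module Sᵐᵒᵖ N] [IsScalarTower k Sᵐᵒᵖ N] : IsScalarTower k S (D k N) where
  smul_assoc a s φ := D.ext fun x => by
    rw [D.smul_apply, D.k_smul_apply, D.smul_apply, op_smul, smul_assoc, map_smul, smul_eq_mul]

instance [Module S N] [IsScalarTower k S N] : IsScalarTower k Sᵐᵒᵖ (D k N) where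
  smul_assoc a s φ := D.ext fun x => by
    rw [D.op_smul_apply, D.k_smul_apply, D.op_smul_apply, unop_smul, smul_assoc, map_smul,
      smul_eq_mul]

/-- The dual of a bimodule is a bimodule. -/
instance [Module S N] [SMulCommClass S k N] [Module Sᵐᵒᵖ N] [SMulCommClass Sᵐᵒᵖ k N]
    [SMulCommClass S Sᵐᵒᵖ N] : SMulCommClass S Sᵐᵒᵖ (D k N) where
  smul_comm s t φ := D.ext fun x => by
    rw [D.smul_apply, D.op_smul_apply, D.op_smul_apply, D.smul_apply, smul_comm]

instance [FiniteDimensional k S] [Module Sᵐᵒᵖ N] [IsScalarTower k Sᵐᵒᵖ N]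
    [Module.Finite Sᵐᵒᵖ N] : Module.Finite S (D k N) :=
  have : Module.Finite k N := Module.Finite.trans Sᵐᵒᵖ N
  Module.Finite.of_restrictScalars_finite k S _

instance [FiniteDimensional k S] [Module S N] [IsScalarTower k S N]
    [Module.Finite S N] : Module.Finite Sᵐᵒᵖ (D k N) :=
  have : Module.Finite k N := Module.Finite.trans S N
  Module.Finite.of_restrictScalars_finite k Sᵐᵒᵖ _

/-- `D S` is an injective left `S`-module. -/
theorem injective_dual (k S : Type u) [Field k] [Ring S] [Algebra k S] :
    Module.Injective S (D k S) where
  out X Y _ _ _ _ f hf g := by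
    let _ : Module k X := Module.compHom X (algebraMap k S)
    let _ : Module k Y := Module.compHom Y (algebraMap k S)
    have : IsScalarTower k S X := ⟨fun a s x => by
      rw [Algebra.smul_def, mul_smul]; rfl⟩
    have : IsScalarTower k S Y := ⟨fun a s x => by
      rw [Algebra.smul_def, mul_smul]; rfl⟩
    let g₁ : X →ₗ[k] k :=
      { toFun := fun x => g x 1
        map_add' := fun x y => by rw [map_add]; rfl
        map_smul' := fun a x => by
          have : a • x = (algebraMap k S a) • x := rfl
          rw [this, map_smul, D.smul_apply, RingHom.id_apply, op_smul_eq_mul, one_mul,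
            Algebra.algebraMap_eq_smul_one, map_smul] }
    let f₁ : X →ₗ[k] Y := f.restrictScalars k
    obtain ⟨e, he⟩ := LinearMap.exists_leftInverse_of_injective f₁ (LinearMap.ker_eq_bot.mpr hf)
    let h₁ : Y →ₗ[k] k := g₁ ∘ₗ e
    refine ⟨{ toFun := fun y => (show S →ₗ[k] k from
                h₁ ∘ₗ ((LinearMap.toSpanSingleton S Y y).restrictScalars k))
              map_add' := fun y z => D.ext fun s => ?_
              map_smul' := fun t y => D.ext fun s => ?_ }, fun x => D.ext fun s => ?_⟩
    · change h₁ (s • (y + z)) = h₁ (s • y) + h₁ (s • z)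
      rw [smul_add, map_add]
    · change h₁ (s • (t • y)) = h₁ ((s * t) • y)
      rw [mul_smul]
    · change g₁ (e (s • f x)) = g x s
      rw [← map_smul]
      have : e (f (s • x)) = s • x := LinearMap.congr_fun he (s • x)
      rw [this]
      change g (s • x) 1 = g x s
      rw [map_smul, D.smul_apply, op_smul_eq_mul, one_mul]

theorem nonempty_injEnv (k S M : Type u) [Field k] [Ring S] [Algebra k S] [FiniteDimensional k S]
    [AddCommGroup M] [Module S M] [Module k M] [IsScalarTower k S M] [Module.Finite S M] :
    Nonempty (InjEnv k S M) := by
  have : IsArtinianRing S := IsArtinianRing.of_finite k S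
  have : Module.Finite k M := Module.Finite.trans S M
  let b := Module.finBasis k M
  let n := Module.finrank k M
  let F := Fin n → D k S
  have : Module.Finite S (D k S) := Module.Finite.of_restrictScalars_finite k S _
  have hFinj : ∀ ⦃X Y : Type u⦄ [AddCommGroup X] [AddCommGroup Y] [Module S X] [Module S Y]
      (f : X →ₗ[S] Y) (_ : Function.Injective f) (g : X →ₗ[S] F),
      ∃ h : Y →ₗ[S] F, ∀ x, h (f x) = g x := by
    intro X Y _ _ _ _ f hf g
    have := fun i => (injective_dual k S).out f hf (LinearMap.proj i ∘ₗ g)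
    choose h hh using this
    exact ⟨LinearMap.pi h, fun x => funext fun i => hh i x⟩
  let ι : M →ₗ[S] F := LinearMap.pi fun i =>
    { toFun := fun m => (show S →ₗ[k] k from
        b.coord i ∘ₗ ((LinearMap.toSpanSingleton S M m).restrictScalars k))
      map_add' := fun y z => D.ext fun s => by
        change b.coord i (s • (y + z)) = b.coord i (s • y) + b.coord i (s • z)
        rw [smul_add, map_add]
      map_smul' := fun t y => D.ext fun s => by
        change b.coord i (s • (t • y)) = b.coord i ((s * t) • y)
        rw [mul_smul] }
  have hι : Function.Injective ι := by
    intro x y hxy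
    apply b.ext_elem
    intro i
    have : b.coord i ((1 : S) • x) = b.coord i ((1 : S) • y) :=
      congrArg (fun φ : F => (φ i) (1 : S)) hxy
    simpa using this
  let T : Set (Submodule S F) := {Q | (∃ Q', IsCompl Q Q') ∧ LinearMap.range ι ≤ Q}
  have hT : T.Nonempty := ⟨⊤, ⟨⊥, isCompl_top_bot⟩, le_top⟩
  obtain ⟨Q, ⟨⟨Q', hQ⟩, hs⟩, hmin⟩ := wellFounded_lt.has_min T hT
  have hinj : Module.Injective S Q := by
    constructor
    intro X Y _ _ _ _ f hf g
    obtain ⟨h, hh⟩ := hFinj f hf (Q.subtype ∘ₗ g)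
    refine ⟨Submodule.projectionOnto Q Q' hQ ∘ₗ h, fun x => ?_⟩
    rw [LinearMap.comp_apply, hh]
    exact Submodule.projectionOnto_apply_left hQ (g x)
  let j : M →ₗ[S] Q := ι.codRestrict Q fun m => hs ⟨m, rfl⟩
  have hj : Function.Injective j := fun x y h => hι (congrArg Subtype.val h)
  refine ⟨{ I := Q, g := j, isEnvelope := ⟨hinj, hj, fun N hN => ?_⟩ }⟩
  have hNj : Function.Injective (N.mkQ ∘ₗ j) := by
    rw [← LinearMap.ker_eq_bot, LinearMap.ker_eq_bot']
    intro m hm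
    have h1 : j m ∈ N := (Submodule.Quotient.mk_eq_zero N).mp hm
    have h2 : j m ∈ N ⊓ LinearMap.range j := ⟨h1, m, rfl⟩
    rw [hN, Submodule.mem_bot] at h2
    exact hj (h2.trans (map_zero j).symm)
  obtain ⟨l, hl⟩ := hinj.out (N.mkQ ∘ₗ j) hNj j
  let h : Module.End S Q := l ∘ₗ N.mkQ
  have hjh : ∀ (m : ℕ) (x : M), (h ^ m) (j x) = j x := by
    intro m x
    induction m with
    | zero => rfl
    | succ m ih =>
      rw [pow_succ', Module.End.mul_apply, ih]
      exact hl x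
  obtain ⟨m, hm⟩ := exists_pow_isCompl h
  set r := LinearMap.range (h ^ (m + 1)) with hr
  have hNker : N ≤ LinearMap.ker (h ^ (m + 1)) := by
    intro x hx
    rw [LinearMap.mem_ker, pow_succ, Module.End.mul_apply]
    have : h x = 0 := by
      change l (N.mkQ x) = 0
      rw [(Submodule.Quotient.mk_eq_zero N).mpr hx |> (show N.mkQ x = 0 from ·), map_zero]
    rw [this, map_zero]
  have hrT : r.map Q.subtype ∈ T := by
    refine ⟨⟨(LinearMap.ker (h ^ (m + 1))).map Q.subtype ⊔ Q', ?_⟩, ?_⟩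
    · have hsup : r.map Q.subtype ⊔ (LinearMap.ker (h ^ (m + 1))).map Q.subtype = Q := by
        rw [← Submodule.map_sup, hm.symm.sup_eq_top, Submodule.map_subtype_top]
      have hinf : Disjoint (r.map Q.subtype) ((LinearMap.ker (h ^ (m + 1))).map Q.subtype) := by
        rw [disjoint_iff, ← Submodule.map_inf _ Q.injective_subtype, hm.symm.inf_eq_bot,
          Submodule.map_bot]
      refine ⟨?_, ?_⟩
      · refine hinf.disjoint_sup_right_of_disjoint_sup_left ?_
        rw [hsup]; exact hQ.disjoint
      · rw [codisjoint_iff, ← sup_assoc, hsup, hQ.sup_eq_top]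
    · rintro _ ⟨x, rfl⟩
      exact ⟨j x, ⟨j x, hjh (m + 1) x⟩, rfl⟩
  have heq : r.map Q.subtype = Q := by
    by_contra hne
    exact hmin _ hrT (lt_of_le_of_ne (Submodule.map_subtype_le Q r) hne)
  have hrtop : r = ⊤ := by
    apply Submodule.map_injective_of_injective Q.injective_subtype
    rw [heq, Submodule.map_subtype_top]
  have hker : LinearMap.ker (h ^ (m + 1)) = ⊥ := by
    have := hm.inf_eq_bot
    rwa [hrtop, inf_top_eq] at this
  exact le_bot_iff.mp (hker ▸ hNker)

end Duality

/-! ### Syzygies, cosyzygies, the transpose and the Auslander-Reiten translations -/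

section Translations

variable (k : Type u) [Field k]

section
variable (S : Type u) [Ring S] [Algebra k S] [FiniteDimensional k S]
variable (M : Type u) [AddCommGroup M] [Module S M] [Module.Finite S M]

/-- A chosen projective cover of the finitely generated module `M`. -/
noncomputable def projCover : ProjCover S M :=
  haveI : IsArtinianRing S := IsArtinianRing.of_finite k S
  Classical.choice (nonempty_projCover S M)

/-- A chosen injective envelope of the finitely generated module `M`. -/
noncomputable def injEnv [Module k M] [IsScalarTower k S M] : InjEnv k S M :=
  Classical.choice (nonempty_injEnv k S M)

/-- The first syzygy `Ω M`, the kernel of a projective cover of `M`. -/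
abbrev syzygy : Type u := LinearMap.ker (projCover k S M).f

/-- The first cosyzygy `Ω⁻¹ M`, the cokernel of an injective envelope of `M`. -/
abbrev cosyzygy [Module k M] [IsScalarTower k S M] : Type u :=
  (injEnv k S M).I ⧸ LinearMap.range (injEnv k S M).g

instance : Module.Finite S (syzygy k S M) :=
  haveI : IsArtinianRing S := IsArtinianRing.of_finite k S
  inferInstance

/-- The map `d : P₁ → P₀` of a minimal projective presentation `P₁ → P₀ → M → 0`. -/
noncomputable def presentationMap :
    (projCover k S (syzygy k S M)).P →ₗ[S] (projCover k S M).P :=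
  (LinearMap.ker (projCover k S M).f).subtype ∘ₗ (projCover k S (syzygy k S M)).f

/-- The map `Hom_S(P₀, S) → Hom_S(P₁, S)` induced by a minimal projective presentation
`P₁ → P₀ → M → 0`. The ring `S` is presented here as an `S`-`T`-bimodule `X`. -/
noncomputable def presentationDual (T X : Type u) [Ring T] [AddCommGroup X] [Module S X]
    [Module T X] [SMulCommClass S T X] :
    ((projCover k S M).P →ₗ[S] X) →ₗ[T] ((projCover k S (syzygy k S M)).P →ₗ[S] X) where
  toFun φ := φ ∘ₗ presentationMap k S M
  map_add' _ _ := rfl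
  map_smul' _ _ := rfl

end

variable (A : Type u) [Ring A] [Algebra k A] [FiniteDimensional k A]

/-- The transpose of a left `A`-module `N`: the cokernel of `Hom_A(P₀, A) → Hom_A(P₁, A)` for a
minimal projective presentation `P₁ → P₀ → N → 0`. It is a right `A`-module. -/
abbrev TrLeft (N : Type u) [AddCommGroup N] [Module A N] [Module.Finite A N] : Type u :=
  ((projCover k A (syzygy k A N)).P →ₗ[A] A) ⧸
    LinearMap.range (presentationDual k A N Aᵐᵒᵖ A)

/-- The transpose of a right `A`-module `M`: the cokernel of `Hom_A(P₀, A) → Hom_A(P₁, A)` for a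
minimal projective presentation `P₁ → P₀ → M → 0`. It is a left `A`-module. -/
abbrev TrRight (M : Type u) [AddCommGroup M] [Module Aᵐᵒᵖ M] [Module.Finite Aᵐᵒᵖ M] : Type u :=
  ((projCover k Aᵐᵒᵖ (syzygy k Aᵐᵒᵖ M)).P →ₗ[Aᵐᵒᵖ] A) ⧸
    LinearMap.range (presentationDual k Aᵐᵒᵖ M A A)

/-- The Auslander-Reiten translation `τ M = D Tr M` of a right `A`-module. -/
abbrev tau (M : Type u) [AddCommGroup M] [Module Aᵐᵒᵖ M] [Module.Finite Aᵐᵒᵖ M] : Type u :=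
  D k (TrRight k A M)

/-- The inverse Auslander-Reiten translation `τ⁻¹ M = Tr D M` of a right `A`-module. -/
abbrev tauInv (M : Type u) [AddCommGroup M] [Module k M] [Module Aᵐᵒᵖ M] [IsScalarTower k Aᵐᵒᵖ M]
    [Module.Finite Aᵐᵒᵖ M] : Type u :=
  TrLeft k A (D k M)

/-- The right `A`-module `M` is `τ_A`-rigid: `Hom_A(M, τ_A M) = 0`. -/
def IsTauRigid (M : Type u) [AddCommGroup M] [Module Aᵐᵒᵖ M] [Module.Finite Aᵐᵒᵖ M] : Prop :=
  ∀ f : M →ₗ[Aᵐᵒᵖ] tau k A M, f = 0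

end Translations

/-! ### The relation extension -/

section RelationExtension

/-- The algebra `A` has global dimension at most `n`: every finitely generated right `A`-module
has projective dimension at most `n`. -/
def GlobalDimLE (A : Type u) [Ring A] (n : ℕ) : Prop :=
  ∀ X : ModuleCat.{u} Aᵐᵒᵖ, Module.Finite Aᵐᵒᵖ X → HasProjectiveDimensionLE X n

variable (k C : Type u) [Field k] [Ring C] [Algebra k C]

/-- `E = Ext²_C(DC, C)`, computed in the category of right `C`-modules. -/
def RelBimodule : Type u :=
  Abelian.Ext.{u} (ModuleCat.of Cᵐᵒᵖ (D k C)) (ModuleCat.of Cᵐᵒᵖ C) 2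

variable {k C} in
/-- An element of `E`, as an element of the `Ext`-group that defines `E`. -/
abbrev RelBimodule.toExt (e : RelBimodule k C) :
    Abelian.Ext.{u} (ModuleCat.of Cᵐᵒᵖ (D k C)) (ModuleCat.of Cᵐᵒᵖ C) 2 := e

noncomputable instance : AddCommGroup (RelBimodule k C) :=
  inferInstanceAs (AddCommGroup (Abelian.Ext.{u} _ _ 2))

variable {C} in
/-- Left multiplication by `c`, an endomorphism of the right module `C`. -/
def mulLeftHom (c : C) : ModuleCat.of Cᵐᵒᵖ C ⟶ ModuleCat.of Cᵐᵒᵖ C :=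
  ModuleCat.ofHom (Module.toModuleEnd Cᵐᵒᵖ (S := C) C c)

variable {C} in
/-- The left action of `c` on the bimodule `DC`, an endomorphism of the right module `DC`. -/
noncomputable def dualLeftHom (c : C) : ModuleCat.of Cᵐᵒᵖ (D k C) ⟶ ModuleCat.of Cᵐᵒᵖ (D k C) :=
  ModuleCat.ofHom (Module.toModuleEnd Cᵐᵒᵖ (S := C) (D k C) c)

theorem mulLeftHom_one : mulLeftHom (1 : C) = 𝟙 _ := by
  rw [mulLeftHom, map_one]; rfl

theorem mulLeftHom_zero : mulLeftHom (0 : C) = 0 := by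
  rw [mulLeftHom, map_zero]; rfl

theorem mulLeftHom_add (c c' : C) : mulLeftHom (c + c') = mulLeftHom c + mulLeftHom c' := by
  rw [mulLeftHom, map_add]; rfl

theorem mulLeftHom_mul (c c' : C) : mulLeftHom (c * c') = mulLeftHom c' ≫ mulLeftHom c := by
  rw [mulLeftHom, map_mul]; rfl

theorem dualLeftHom_one : dualLeftHom k (1 : C) = 𝟙 _ := by
  rw [dualLeftHom, map_one]; rfl

theorem dualLeftHom_zero : dualLeftHom k (0 : C) = 0 := by
  rw [dualLeftHom, map_zero]; rfl

theorem dualLeftHom_add (c c' : C) :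
    dualLeftHom k (c + c') = dualLeftHom k c + dualLeftHom k c' := by
  rw [dualLeftHom, map_add]; rfl

theorem dualLeftHom_mul (c c' : C) :
    dualLeftHom k (c * c') = dualLeftHom k c' ≫ dualLeftHom k c := by
  rw [dualLeftHom, map_mul]; rfl

theorem mk₀_eq_smul {S : Type u} [Ring S] [Algebra k S] {X Y : ModuleCat.{u} S} (a : k)
    (f g : X ⟶ Y) (h : ∀ x, g.hom x = algebraMap k S a • f.hom x) :
    Abelian.Ext.mk₀ g = a • Abelian.Ext.mk₀ f := by
  rw [← Abelian.Ext.mk₀_smul]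
  congr 1
  exact ModuleCat.hom_ext (LinearMap.ext h)

theorem mk₀_mulLeftHom_smul (a : k) (c : C) :
    Abelian.Ext.mk₀ (mulLeftHom (a • c)) = a • Abelian.Ext.mk₀ (mulLeftHom c) := by
  refine mk₀_eq_smul k a _ _ fun x => ?_
  change (a • c) * x = (algebraMap k Cᵐᵒᵖ a) • (c * x)
  rw [algebraMap_smul, smul_mul_assoc]

theorem mk₀_dualLeftHom_smul (a : k) (c : C) :
    Abelian.Ext.mk₀ (dualLeftHom k (a • c)) = a • Abelian.Ext.mk₀ (dualLeftHom k c) := by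
  refine mk₀_eq_smul k a _ _ fun φ => ?_
  change (a • c) • φ = (algebraMap k Cᵐᵒᵖ a) • (c • φ)
  rw [algebraMap_smul, smul_assoc]

section Actions

open Abelian

variable {k C}

/-- The action of `c` on the second argument of `Ext²_C(DC, C)`. -/
noncomputable def extLeft (c : C) (e : Ext.{u} (ModuleCat.of Cᵐᵒᵖ (D k C)) (ModuleCat.of Cᵐᵒᵖ C) 2) :
    Ext.{u} (ModuleCat.of Cᵐᵒᵖ (D k C)) (ModuleCat.of Cᵐᵒᵖ C) 2 :=
  e.comp (Ext.mk₀ (mulLeftHom c)) (add_zero 2)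

/-- The action of `c` on the first argument of `Ext²_C(DC, C)`. -/
noncomputable def extRight (c : C) (e : Ext.{u} (ModuleCat.of Cᵐᵒᵖ (D k C)) (ModuleCat.of Cᵐᵒᵖ C) 2) :
    Ext.{u} (ModuleCat.of Cᵐᵒᵖ (D k C)) (ModuleCat.of Cᵐᵒᵖ C) 2 :=
  (Ext.mk₀ (dualLeftHom k c)).comp e (zero_add 2)

theorem extLeft_one (e : Ext.{u} (ModuleCat.of Cᵐᵒᵖ (D k C)) (ModuleCat.of Cᵐᵒᵖ C) 2) : extLeft 1 e = e := by
  rw [extLeft, mulLeftHom_one, Ext.comp_mk₀_id]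

theorem extLeft_zero (e : Ext.{u} (ModuleCat.of Cᵐᵒᵖ (D k C)) (ModuleCat.of Cᵐᵒᵖ C) 2) : extLeft 0 e = 0 := by
  rw [extLeft, mulLeftHom_zero, Ext.mk₀_zero, Ext.comp_zero]

theorem extLeft_add (c c' : C) (e : Ext.{u} (ModuleCat.of Cᵐᵒᵖ (D k C)) (ModuleCat.of Cᵐᵒᵖ C) 2) : extLeft (c + c') e = extLeft c e + extLeft c' e := by
  rw [extLeft, mulLeftHom_add, Ext.mk₀_add, Ext.comp_add]; rfl

theorem extLeft_mul (c c' : C) (e : Ext.{u} (ModuleCat.of Cᵐᵒᵖ (D k C)) (ModuleCat.of Cᵐᵒᵖ C) 2) : extLeft (c * c') e = extLeft c (extLeft c' e) := by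
  rw [extLeft, extLeft, extLeft, Ext.comp_assoc_of_third_deg_zero, Ext.mk₀_comp_mk₀,
    mulLeftHom_mul]

theorem extRight_one (e : Ext.{u} (ModuleCat.of Cᵐᵒᵖ (D k C)) (ModuleCat.of Cᵐᵒᵖ C) 2) : extRight 1 e = e := by
  rw [extRight, dualLeftHom_one, Ext.mk₀_id_comp]

theorem extRight_zero (e : Ext.{u} (ModuleCat.of Cᵐᵒᵖ (D k C)) (ModuleCat.of Cᵐᵒᵖ C) 2) : extRight 0 e = 0 := by
  rw [extRight, dualLeftHom_zero, Ext.mk₀_zero, Ext.zero_comp]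

theorem extRight_add (c c' : C) (e : Ext.{u} (ModuleCat.of Cᵐᵒᵖ (D k C)) (ModuleCat.of Cᵐᵒᵖ C) 2) : extRight (c + c') e = extRight c e + extRight c' e := by
  rw [extRight, dualLeftHom_add, Ext.mk₀_add, Ext.add_comp]; rfl

theorem extRight_mul (c c' : C) (e : Ext.{u} (ModuleCat.of Cᵐᵒᵖ (D k C)) (ModuleCat.of Cᵐᵒᵖ C) 2) : extRight (c' * c) e = extRight c (extRight c' e) := by
  rw [extRight, extRight, extRight, Ext.mk₀_comp_mk₀_assoc, dualLeftHom_mul]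

theorem extLeft_smul (a : k) (c : C) (e : Ext.{u} (ModuleCat.of Cᵐᵒᵖ (D k C)) (ModuleCat.of Cᵐᵒᵖ C) 2) : extLeft (a • c) e = a • extLeft c e := by
  rw [extLeft, mk₀_mulLeftHom_smul, Ext.comp_smul]; rfl

theorem extRight_smul (a : k) (c : C) (e : Ext.{u} (ModuleCat.of Cᵐᵒᵖ (D k C)) (ModuleCat.of Cᵐᵒᵖ C) 2) : extRight (a • c) e = a • extRight c e := by
  rw [extRight, mk₀_dualLeftHom_smul, Ext.smul_comp]; rfl

end Actions

/-- The left action of `C` on `E` is induced by the left action on the second argument `C`. -/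
noncomputable instance : Module C (RelBimodule k C) where
  smul c e := extLeft c e.toExt
  one_smul e := extLeft_one e.toExt
  mul_smul c c' e := extLeft_mul c c' e.toExt
  smul_zero _ := Abelian.Ext.zero_comp _ _ _ _ (add_zero 2)
  smul_add _ e e' := Abelian.Ext.add_comp e.toExt e'.toExt _ (add_zero 2)
  add_smul c c' e := extLeft_add c c' e.toExt
  zero_smul e := extLeft_zero e.toExt

/-- The right action of `C` on `E` is induced by the left action on the first argument `DC`. -/
noncomputable instance : Module Cᵐᵒᵖ (RelBimodule k C) where
  smul c e := extRight c.unop e.toExt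
  one_smul e := extRight_one e.toExt
  mul_smul c c' e := extRight_mul c.unop c'.unop e.toExt
  smul_zero _ := Abelian.Ext.comp_zero _ _ _ _ (zero_add 2)
  smul_add _ e e' := Abelian.Ext.comp_add _ e.toExt e'.toExt (zero_add 2)
  add_smul c c' e := extRight_add c.unop c'.unop e.toExt
  zero_smul e := extRight_zero e.toExt

instance : SMulCommClass C Cᵐᵒᵖ (RelBimodule k C) where
  smul_comm c c' e := Abelian.Ext.comp_assoc_of_third_deg_zero
    (Abelian.Ext.mk₀ (dualLeftHom k c'.unop)) e.toExt (Abelian.Ext.mk₀ (mulLeftHom c)) (zero_add 2)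

noncomputable instance : Module k (RelBimodule k C) :=
  inferInstanceAs (Module k (Abelian.Ext.{u} _ _ 2))

instance : IsScalarTower k C (RelBimodule k C) where
  smul_assoc a c e := extLeft_smul a c e.toExt

instance : IsScalarTower k Cᵐᵒᵖ (RelBimodule k C) where
  smul_assoc a c e := extRight_smul a c.unop e.toExt

theorem finite_ext (S : Type u) [Ring S] [Algebra k S] [FiniteDimensional k S]
    (X Y : ModuleCat.{u} S) [Module.Finite S X] [Module.Finite S Y] (i : ℕ) :
    Module.Finite k (Abelian.Ext.{u} X Y i) := by
  have : IsArtinianRing S := IsArtinianRing.of_finite k S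
  induction i generalizing X with
  | zero =>
    let _ : Module k X := Module.compHom X (algebraMap k S)
    let _ : Module k Y := Module.compHom Y (algebraMap k S)
    have : IsScalarTower k S X := ⟨fun a s x => by
      rw [Algebra.smul_def, mul_smul]; rfl⟩
    have : IsScalarTower k S Y := ⟨fun a s x => by
      rw [Algebra.smul_def, mul_smul]; rfl⟩
    have : Module.Finite k X := Module.Finite.trans S X
    have : Module.Finite k Y := Module.Finite.trans S Y
    let φ : (X ⟶ Y) →ₗ[k] (X →ₗ[k] Y) :=
      { toFun := fun f => f.hom.restrictScalars k
        map_add' := fun _ _ => rfl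
        map_smul' := fun _ _ => rfl }
    have hφ : Function.Injective φ := fun f g h => by
      ext x
      exact LinearMap.congr_fun h x
    have : Module.Finite k (X ⟶ Y) := Module.Finite.of_injective φ hφ
    exact Module.Finite.equiv (Abelian.Ext.linearEquiv₀ (R := k) (X := X) (Y := Y)).symm
  | succ n ih =>
    obtain ⟨m, f, surjf⟩ := Module.Finite.exists_fin' S X
    let exac := LinearMap.shortExact_shortComplexKer surjf
    have := ih (ModuleCat.of S (LinearMap.ker f))
    exact Module.Finite.of_surjective (exac.extClass.precompOfLinear k Y (add_comm 1 n))
      (precomp_extClass_surjective_of_projective_X₂ Y exac n)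

instance [FiniteDimensional k C] : FiniteDimensional k (RelBimodule k C) :=
  have : Module.Finite Cᵐᵒᵖ C := Module.Finite.of_restrictScalars_finite k Cᵐᵒᵖ C
  finite_ext k Cᵐᵒᵖ (ModuleCat.of Cᵐᵒᵖ (D k C)) (ModuleCat.of Cᵐᵒᵖ C) 2

/-- The relation extension `B = C ⋉ E`, the trivial extension of `C` by `E`. -/
abbrev RelExt : Type u := TrivSqZeroExt C (RelBimodule k C)

instance [FiniteDimensional k C] : FiniteDimensional k (RelExt k C) :=
  inferInstanceAs (FiniteDimensional k (C × RelBimodule k C))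

/-- A right `C`-module `M` viewed as a right `B`-module, through `m (c, e) = m c`. -/
def Inflation (_k _C M : Type u) : Type u := M

section
variable (M : Type u) [AddCommGroup M] [Module Cᵐᵒᵖ M]

instance : AddCommGroup (Inflation k C M) := inferInstanceAs (AddCommGroup M)

noncomputable instance : Module (RelExt k C)ᵐᵒᵖ (Inflation k C M) :=
  Module.compHom M (TrivSqZeroExt.fstHom k C (RelBimodule k C)).toRingHom.op

theorem inflation_smul (b : RelExt k C) (m : M) :
    (show M from op b • (show Inflation k C M from m)) = op b.fst • m := rfl

instance [Module.Finite Cᵐᵒᵖ M] : Module.Finite (RelExt k C)ᵐᵒᵖ (Inflation k C M) := by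
  obtain ⟨s, hs⟩ := (Module.Finite.fg_top : (⊤ : Submodule Cᵐᵒᵖ M).FG)
  have key : ∀ m : M, m ∈ Submodule.span Cᵐᵒᵖ (s : Set M) →
      (show Inflation k C M from m) ∈ Submodule.span (RelExt k C)ᵐᵒᵖ (show Set (Inflation k C M) from (s : Set M)) := by
    intro m hm
    induction hm using Submodule.span_induction with
    | mem x hx => exact Submodule.subset_span hx
    | zero => exact Submodule.zero_mem _
    | add x y _ _ hx hy => exact Submodule.add_mem _ hx hy
    | smul c x _ hx =>
      exact Submodule.smul_mem _ (op (TrivSqZeroExt.inl c.unop : RelExt k C)) hx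
  exact ⟨⟨(show Finset (Inflation k C M) from s), eq_top_iff.mpr fun m _ => key m (hs ▸ trivial)⟩⟩

end

end RelationExtension

end ArtinAlg

universe w v

/-! For a semisimple module, τ-rigidity reduces to the vanishing of self-extensions. By
`isTauRigid_iff`, M is τ-rigid exactly when every map P₁ → M factors through the minimal
presentation P₁ → P₀; a map to a semisimple module kills the superfluous kernel of P₁ → ΩM, so it
comes from ΩM.

Let π : P → M be a projective cover over B, and take h : ker π → M. Since E annihilates M, PE lies
in ker π, and h restricted to PE induces a C-linear map M ⊗_C E → M. If every such map is zero, then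
h kills PE. Over C, h extends to P because M is τ_C-rigid, and the extension kills PE, so it is
B-linear. This is `isTauRigid_inflation`; what remains is Hom_C(M ⊗_C E, M) = 0.

For (a), Ext²(DC, P₀) ≅ P₀ ⊗ E maps onto M ⊗ E, and Ext²(DC, P₀) is a quotient of τ⁻¹Ω⁻¹P₀. For (b),
Hom(M ⊗ E, I₀) ≅ Hom(M, D Ext²(I₀, C)), and D Ext²(I₀, C) embeds in τΩI₀. Both facts about Ext² come
from Yoneda products with the class of a spliced exact sequence. Global dimension at most 2 makes
the last syzygy projective, hence equal to the term whose dual appears in the transpose.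

No tensor product is formed: a map M ⊗ E → M is a balanced biadditive map (`IsTensorHom`), and the
isomorphisms above are replaced by a dual basis of P₀ and a splitting of I₀ off a power of DC. -/

namespace ArtinAlg

/-! ### Lifting, superfluous kernels and dual bases -/

section LinearAlgebra

/-- A linear map that kills the kernel of a surjection factors through it. -/
theorem exists_comp_eq_of_ker_le {S X Y Z : Type*} [Ring S] [AddCommGroup X] [Module S X]
    [AddCommGroup Y] [Module S Y] [AddCommGroup Z] [Module S Z] (σ : X →ₗ[S] Y) (φ : X →ₗ[S] Z)
    (hσ : Function.Surjective σ) (h : ∀ x, σ x = 0 → φ x = 0) :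
    ∃ ψ : Y →ₗ[S] Z, ∀ x, ψ (σ x) = φ x := by
  have hle : LinearMap.ker σ ≤ LinearMap.ker φ := fun x hx => h x hx
  refine ⟨(LinearMap.ker σ).liftQ φ hle ∘ₗ (σ.quotKerEquivOfSurjective hσ).symm.toLinearMap,
    fun x => ?_⟩
  have : (σ.quotKerEquivOfSurjective hσ).symm (σ x) = (LinearMap.ker σ).mkQ x := by
    rw [LinearEquiv.symm_apply_eq]; rfl
  simp [this]

/-- Extending maps from the kernel of one projective presentation of `M` suffices to extend maps
from the kernel of an arbitrary surjection onto `M`. -/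
theorem exists_extend_of_ker {S P X M N : Type*} [Ring S] [AddCommGroup P] [Module S P]
    [AddCommGroup X] [Module S X] [AddCommGroup M] [Module S M] [AddCommGroup N] [Module S N]
    [Module.Projective S P] (f : P →ₗ[S] M) (hf : Function.Surjective f)
    (hext : ∀ h : LinearMap.ker f →ₗ[S] N, ∃ t : P →ₗ[S] N, ∀ x : LinearMap.ker f, t x = h x)
    (π : X →ₗ[S] M) (hπ : Function.Surjective π) (h : LinearMap.ker π →ₗ[S] N) :
    ∃ t : X →ₗ[S] N, ∀ x : LinearMap.ker π, t x = h x := by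
  obtain ⟨s, hs⟩ := Module.projective_lifting_property π f hπ
  have hs' : ∀ p, π (s p) = f p := fun p => LinearMap.congr_fun hs p
  obtain ⟨t, ht⟩ := hext (h ∘ₗ (s.restrict (p := LinearMap.ker f) (q := LinearMap.ker π)
    fun p hp => by rw [LinearMap.mem_ker, hs']; exact hp))
  -- X is the pushout of ker π and P along ker f: the sum map ker π × P → X is onto, and its kernel
  -- consists of the pairs (-s p, p) with p in ker f, on which h and t cancel.
  obtain ⟨ψ, hψ⟩ := exists_comp_eq_of_ker_le ((LinearMap.ker π).subtype.coprod s) (h.coprod t)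
    (fun x => by
      obtain ⟨p, hp⟩ := hf (π x)
      refine ⟨(⟨x - s p, ?_⟩, p), ?_⟩
      · rw [LinearMap.mem_ker, map_sub, hs', hp, sub_self]
      · simp)
    (fun ⟨κ, p⟩ hκ => by
      have h1 : (κ : X) + s p = 0 := by simpa using hκ
      have hp : f p = 0 := by
        have := congrArg π h1
        rwa [map_add, κ.2, zero_add, hs', map_zero] at this
      have h2 := ht ⟨p, hp⟩
      have h3 : κ = - (s.restrict (p := LinearMap.ker f) (q := LinearMap.ker π)
          (fun p hp => by rw [LinearMap.mem_ker, hs']; exact hp)) ⟨p, hp⟩ :=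
        Subtype.ext (eq_neg_of_add_eq_zero_left h1)
      rw [LinearMap.coprod_apply]
      change h κ + t p = 0
      rw [show t p = _ from h2, h3, map_neg, LinearMap.comp_apply, neg_add_cancel])
  refine ⟨ψ, fun x => ?_⟩
  have := hψ (x, 0)
  simpa using this

/-- A projective cover of a projective module is an isomorphism. -/
theorem IsProjectiveCover.bijective {S P K : Type u} [Ring S] [AddCommGroup P] [Module S P]
    [AddCommGroup K] [Module S K] [Module.Projective S K] {f : P →ₗ[S] K}
    (hf : IsProjectiveCover f) : Function.Bijective f := by
  obtain ⟨-, hs, hmin⟩ := hf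
  obtain ⟨σ, hσ⟩ := Module.projective_lifting_property f LinearMap.id hs
  have hσ' : ∀ x, f (σ x) = x := fun x => LinearMap.congr_fun hσ x
  -- The image of the section σ and ker f together span P, and ker f is superfluous.
  have htop : LinearMap.range σ = ⊤ := by
    refine hmin _ (eq_top_iff.mpr fun x _ => Submodule.mem_sup.mpr
      ⟨σ (f x), ⟨f x, rfl⟩, x - σ (f x), ?_, by abel⟩)
    rw [LinearMap.mem_ker, map_sub, hσ', sub_self]
  refine ⟨(injective_iff_map_eq_zero f).mpr fun x hx => ?_, hs⟩
  obtain ⟨y, rfl⟩ : x ∈ LinearMap.range σ := htop ▸ trivial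
  rw [hσ'] at hx
  rw [hx, map_zero]

/-- A map to a semisimple module kills superfluous submodules. -/
theorem eq_zero_of_superfluous {S P M : Type*} [Ring S] [AddCommGroup P] [Module S P]
    [AddCommGroup M] [Module S M] [IsSemisimpleModule S M] (K : Submodule S P)
    (hK : ∀ N : Submodule S P, N ⊔ K = ⊤ → N = ⊤) (h : P →ₗ[S] M) {x : P} (hx : x ∈ K) :
    h x = 0 := by
  -- The preimage of a complement M' of h(K) spans P together with K, so it is all of P, and h(K)
  -- lies in M' ∩ h(K) = 0.
  obtain ⟨M', hM'⟩ := exists_isCompl (K.map h)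
  have htop : M'.comap h = ⊤ := by
    refine hK _ (eq_top_iff.mpr fun p _ => ?_)
    obtain ⟨y, hy, z, hz, hyz⟩ := Submodule.mem_sup.mp
      (show h p ∈ K.map h ⊔ M' from hM'.sup_eq_top ▸ trivial)
    obtain ⟨q, hq, rfl⟩ := hy
    refine Submodule.mem_sup.mpr ⟨p - q, ?_, q, hq, by abel⟩
    rw [Submodule.mem_comap, map_sub, ← hyz, add_sub_cancel_left]
    exact hz
  have h1 : h x ∈ K.map h ⊓ M' :=
    ⟨Submodule.mem_map_of_mem hx, show x ∈ M'.comap h from htop ▸ trivial⟩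
  rwa [hM'.inf_eq_bot] at h1

/-- A dual basis of a finitely generated projective right module. -/
theorem exists_dualBasis_right (A P : Type*) [Ring A] [AddCommGroup P] [Module Aᵐᵒᵖ P]
    [Module.Finite Aᵐᵒᵖ P] [Module.Projective Aᵐᵒᵖ P] :
    ∃ (n : ℕ) (x : Fin n → P) (φ : Fin n → P →ₗ[Aᵐᵒᵖ] A), ∀ p, ∑ i, op (φ i p) • x i = p := by
  obtain ⟨n, f, g, -, -, hfg⟩ := Module.Finite.exists_comp_eq_id_of_projective Aᵐᵒᵖ P
  refine ⟨n, fun i => f (Pi.single i 1), fun i =>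
    { toFun := fun p => unop (g p i)
      map_add' := fun p q => by simp
      map_smul' := fun a p => by simp }, fun p => ?_⟩
  have hp : f (g p) = p := LinearMap.congr_fun hfg p
  conv_rhs => rw [← hp, pi_eq_sum_univ' (g p)]
  rw [map_sum]
  refine Finset.sum_congr rfl fun i _ => ?_
  change op (unop (g p i)) • f (Pi.single i 1) = _
  rw [op_unop, ← map_smul]

/-- Multiplication by elements of `N`: the map `p ↦ n φ(p)`. -/
def smulHom {A P N : Type*} [Ring A] [AddCommGroup P] [Module Aᵐᵒᵖ P] [AddCommGroup N]
    [Module Aᵐᵒᵖ N] (n : N) (φ : P →ₗ[Aᵐᵒᵖ] A) : P →ₗ[Aᵐᵒᵖ] N where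
  toFun p := op (φ p) • n
  map_add' p q := by rw [map_add, ← add_smul]; rfl
  map_smul' a p := by
    rw [map_smul, RingHom.id_apply, smul_smul]; rfl

@[simp] theorem smulHom_apply {A P N : Type*} [Ring A] [AddCommGroup P] [Module Aᵐᵒᵖ P]
    [AddCommGroup N] [Module Aᵐᵒᵖ N] (n : N) (φ : P →ₗ[Aᵐᵒᵖ] A) (p : P) :
    smulHom n φ p = op (φ p) • n := rfl

end LinearAlgebra

/-! ### τ-rigidity through minimal presentations and self-extensions -/

section TauRigid

variable {k : Type u} [Field k] {A : Type u} [Ring A] [Algebra k A]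

/-- A family of functionals on `V` indexed by a right module `N` that vanish on the submodule `W`
and are compatible with the actions of `A` defines a map `N → D (V / W)`. -/
theorem exists_hom_dual_quotient {N V : Type u} [AddCommGroup N] [Module Aᵐᵒᵖ N]
    [AddCommGroup V] [Module k V] [Module A V] [IsScalarTower k A V] (W : Submodule A V)
    (χ : N → V →ₗ[k] k) (hadd : ∀ z z' v, χ (z + z') v = χ z v + χ z' v)
    (hsmul : ∀ (a : A) z v, χ (op a • z) v = χ z (a • v)) (hW : ∀ z, ∀ w ∈ W, χ z w = 0) :
    ∃ ψ : N →ₗ[Aᵐᵒᵖ] D k (V ⧸ W), ∀ z v, ψ z (Submodule.Quotient.mk v) = χ z v := by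
  let F : N → (V ⧸ W →ₗ[k] k) := fun z =>
    (W.restrictScalars k).liftQ (χ z) (fun w hw => hW z w hw) ∘ₗ
      (Submodule.Quotient.restrictScalarsEquiv k W).symm.toLinearMap
  have hF : ∀ z v, F z (Submodule.Quotient.mk v) = χ z v := fun z v => rfl
  refine ⟨{ toFun := fun z => (show D k (V ⧸ W) from F z)
            map_add' := fun z z' => D.ext fun q => ?_
            map_smul' := fun a z => D.ext fun q => ?_ }, hF⟩
  · obtain ⟨v, rfl⟩ := Submodule.Quotient.mk_surjective W q
    exact hadd z z' v
  · obtain ⟨v, rfl⟩ := Submodule.Quotient.mk_surjective W q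
    exact hsmul a.unop z v

variable (k A) [FiniteDimensional k A]
variable (M : Type u) [AddCommGroup M] [Module Aᵐᵒᵖ M] [Module.Finite Aᵐᵒᵖ M]

/-- `M` is `τ`-rigid if and only if every map `P₁ → M` factors through the minimal projective
presentation `P₁ → P₀` of `M`. -/
theorem isTauRigid_iff :
    IsTauRigid k A M ↔ ∀ h : (projCover k Aᵐᵒᵖ (syzygy k Aᵐᵒᵖ M)).P →ₗ[Aᵐᵒᵖ] M,
      ∃ t : (projCover k Aᵐᵒᵖ M).P →ₗ[Aᵐᵒᵖ] M, h = t ∘ₗ presentationMap k Aᵐᵒᵖ M := by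
  let _ : Module k M := Module.compHom M (algebraMap k Aᵐᵒᵖ)
  have _ : IsScalarTower k Aᵐᵒᵖ M := ⟨fun a s x => by
    rw [Algebra.smul_def, mul_smul]; rfl⟩
  have hP₁ := (projCover k Aᵐᵒᵖ (syzygy k Aᵐᵒᵖ M)).isCover.1
  have hP₀ := (projCover k Aᵐᵒᵖ M).isCover.1
  obtain ⟨m, x, φ, hx⟩ := exists_dualBasis_right A (projCover k Aᵐᵒᵖ (syzygy k Aᵐᵒᵖ M)).P
  obtain ⟨n, y, ψ, hy⟩ := exists_dualBasis_right A (projCover k Aᵐᵒᵖ M).P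
  constructor
  · intro hM h
    -- If h lay outside the subspace W of maps that factor, a functional θ would separate it from W.
    -- Then z ↦ (φ ↦ θ(z φ)) is a map M → D Tr M, so rigidity makes θ vanish on all maps z φ.
    let W : Submodule k ((projCover k Aᵐᵒᵖ (syzygy k Aᵐᵒᵖ M)).P →ₗ[Aᵐᵒᵖ] M) :=
      { carrier := {h | ∃ t : (projCover k Aᵐᵒᵖ M).P →ₗ[Aᵐᵒᵖ] M,
          h = t ∘ₗ presentationMap k Aᵐᵒᵖ M}
        add_mem' := by
          rintro _ _ ⟨t, rfl⟩ ⟨t', rfl⟩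
          exact ⟨t + t', rfl⟩
        zero_mem' := ⟨0, rfl⟩
        smul_mem' := by
          rintro a _ ⟨t, rfl⟩
          exact ⟨a • t, rfl⟩ }
    change h ∈ W
    by_contra hh
    obtain ⟨θ, hθ, hθW⟩ := W.exists_dual_map_eq_bot_of_notMem hh inferInstance
    have hθ0 : ∀ w ∈ W, θ w = 0 := fun w hw => by
      have : θ w ∈ W.map θ := Submodule.mem_map_of_mem hw
      rwa [hθW] at this
    obtain ⟨χ, hχ⟩ := exists_hom_dual_quotient (k := k)
      (LinearMap.range (presentationDual k Aᵐᵒᵖ M A A))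
      (fun z : M =>
        { toFun := fun φ => θ (smulHom z φ)
          map_add' := fun φ φ' => by
            rw [← map_add]; congr 1; ext p
            exact add_smul (op (φ p)) (op (φ' p)) z
          map_smul' := fun a φ => by
            rw [RingHom.id_apply, ← map_smul]; congr 1; ext p
            exact smul_assoc a (op (φ p)) z })
      (fun z z' φ => by
        change θ _ = θ _ + θ _
        rw [← map_add]; congr 1; ext p
        exact smul_add _ z z')
      (fun a z φ => by
        change θ _ = θ _
        congr 1; ext p
        exact smul_smul _ _ _)
      (by
        rintro z _ ⟨φ, rfl⟩
        exact hθ0 _ ⟨smulHom z φ, rfl⟩)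
    have h0 : ∀ z φ, θ (smulHom z φ) = 0 := fun z φ => by
      refine (hχ z φ).symm.trans ?_
      rw [hM χ]; rfl
    apply hθ
    -- By the dual basis of P₁, the maps z φ span Hom(P₁, M).
    have : h = ∑ i, smulHom (h (x i)) (φ i) := by
      ext p
      conv_lhs => rw [← hx p]
      simp
    rw [this, map_sum]
    exact Finset.sum_eq_zero fun i _ => h0 _ _
  · intro hM χ
    refine LinearMap.ext fun z => D.ext fun q => ?_
    obtain ⟨q, rfl⟩ := Submodule.Quotient.mk_surjective _ q
    obtain ⟨t, ht⟩ := hM (smulHom z q)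
    let mk : ((projCover k Aᵐᵒᵖ (syzygy k Aᵐᵒᵖ M)).P →ₗ[Aᵐᵒᵖ] A) →ₗ[A] TrRight k A M :=
      Submodule.mkQ _
    have hχ : ∀ z a v, χ (op a • z) (mk v) = χ z (mk (a • v)) := fun z a v => by
      rw [map_smul, map_smul]; rfl
    -- The dual basis of P₁ extends χ to the functional h ↦ ∑ χ(h xᵢ)(φᵢ) on Hom(P₁, M), whose value
    -- at z v is χ(z)(v).
    have key : ∀ h : (projCover k Aᵐᵒᵖ (syzygy k Aᵐᵒᵖ M)).P →ₗ[Aᵐᵒᵖ] M, ∀ z v,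
        h = smulHom z v → ∑ i, χ (h (x i)) (mk (φ i)) = χ z (mk v) := by
      rintro _ z v rfl
      simp only [smulHom_apply, hχ]
      rw [← map_sum, ← map_sum]
      congr 2
      ext p
      have h1 : v p = v (∑ i, op (φ i p) • x i) := by rw [hx]
      rw [h1, map_sum, LinearMap.sum_apply]
      exact Finset.sum_congr rfl fun i _ => (map_smul v _ _).symm
    -- With d the presentation map, the dual basis of P₀ writes t ∘ d as a sum of the maps t(yⱼ)(ψⱼ
    -- ∘ d); each contributes zero because ψⱼ ∘ d vanishes in Tr M.
    have h0 : ∀ j, ∑ i, χ (op (ψ j (presentationMap k Aᵐᵒᵖ M (x i))) • t (y j)) (mk (φ i)) = 0 := by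
      intro j
      refine (key (smulHom (t (y j)) (ψ j ∘ₗ presentationMap k Aᵐᵒᵖ M)) _ _ rfl).trans ?_
      have : mk (ψ j ∘ₗ presentationMap k Aᵐᵒᵖ M) = 0 :=
        (Submodule.Quotient.mk_eq_zero _).mpr ⟨ψ j, rfl⟩
      rw [this, map_zero]
    change χ z (mk q) = 0
    rw [← key _ z q rfl, ht]
    have h2 : ∀ i, (t ∘ₗ presentationMap k Aᵐᵒᵖ M) (x i) =
        ∑ j, op (ψ j (presentationMap k Aᵐᵒᵖ M (x i))) • t (y j) := fun i => by
      rw [LinearMap.comp_apply]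
      conv_lhs => rw [← hy (presentationMap k Aᵐᵒᵖ M (x i)), map_sum]
      simp only [map_smul]
    have h3 : ∀ i, χ ((t ∘ₗ presentationMap k Aᵐᵒᵖ M) (x i)) (mk (φ i)) =
        ∑ j, χ (op (ψ j (presentationMap k Aᵐᵒᵖ M (x i))) • t (y j)) (mk (φ i)) := fun i => by
      rw [h2, map_sum]
      exact map_sum (AddMonoidHom.mk' (fun f : tau k A M => f (mk (φ i))) fun _ _ => rfl) _ _
    simp only [h3]
    rw [Finset.sum_comm]
    exact Finset.sum_eq_zero fun j _ => h0 j

variable {M}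

/-- A `τ`-rigid module has no self-extensions. -/
theorem IsTauRigid.exists_extend (hM : IsTauRigid k A M) {X : Type*} [AddCommGroup X]
    [Module Aᵐᵒᵖ X] (π : X →ₗ[Aᵐᵒᵖ] M) (hπ : Function.Surjective π)
    (h : LinearMap.ker π →ₗ[Aᵐᵒᵖ] M) :
    ∃ t : X →ₗ[Aᵐᵒᵖ] M, ∀ x : LinearMap.ker π, t x = h x := by
  have := (projCover k Aᵐᵒᵖ M).isCover.1
  refine exists_extend_of_ker _ (projCover k Aᵐᵒᵖ M).isCover.2.1 (fun h => ?_) π hπ h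
  obtain ⟨t, ht⟩ := (isTauRigid_iff k A M).mp hM (h ∘ₗ (projCover k Aᵐᵒᵖ (syzygy k Aᵐᵒᵖ M)).f)
  refine ⟨t, fun x => ?_⟩
  obtain ⟨p, rfl⟩ := (projCover k Aᵐᵒᵖ (syzygy k Aᵐᵒᵖ M)).isCover.2.1 x
  exact (LinearMap.congr_fun ht p).symm

/-- A semisimple module is `τ`-rigid as soon as it has no self-extensions. -/
theorem isTauRigid_of_exists_extend [IsSemisimpleModule Aᵐᵒᵖ M]
    (hM : ∀ h : syzygy k Aᵐᵒᵖ M →ₗ[Aᵐᵒᵖ] M, ∃ t : (projCover k Aᵐᵒᵖ M).P →ₗ[Aᵐᵒᵖ] M,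
      ∀ x : syzygy k Aᵐᵒᵖ M, t x = h x) : IsTauRigid k A M := by
  refine (isTauRigid_iff k A M).mpr fun h => ?_
  obtain ⟨-, hs, hmin⟩ := (projCover k Aᵐᵒᵖ (syzygy k Aᵐᵒᵖ M)).isCover
  obtain ⟨h', hh'⟩ := exists_comp_eq_of_ker_le _ h hs
    fun x hx => eq_zero_of_superfluous _ hmin h hx
  obtain ⟨t, ht⟩ := hM h'
  exact ⟨t, LinearMap.ext fun x => ((ht _).trans (hh' x)).symm⟩

end TauRigid

/-! ### Passage from C to the relation extension B -/

section RelationExtensionRigidity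

variable {k C : Type u} [Field k] [Ring C] [Algebra k C]
variable {M : Type u} [AddCommGroup M] [Module Cᵐᵒᵖ M]

/-- The biadditive map `μ : M × E → M` comes from a map `M ⊗_C E → M` of right `C`-modules. -/
def IsTensorHom (μ : M →+ RelBimodule k C →+ M) : Prop :=
  (∀ (c : C) m e, μ (op c • m) e = μ m (c • e)) ∧
    ∀ (c : C) m e, μ m (op c • e) = op c • μ m e

/-- B maps onto C, so M has the same submodules over both rings. -/
instance isSemisimpleModule_inflation [IsSemisimpleModule Cᵐᵒᵖ M] :
    IsSemisimpleModule (RelExt k C)ᵐᵒᵖ (Inflation k C M) := by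
  let σ : (RelExt k C)ᵐᵒᵖ →+* Cᵐᵒᵖ := (TrivSqZeroExt.fstHom k C (RelBimodule k C)).toRingHom.op
  have hσ : RingHomSurjective σ := ⟨fun c => ⟨op (TrivSqZeroExt.inl c.unop), rfl⟩⟩
  let l : Inflation k C M →ₛₗ[σ] M :=
    { toFun := fun m => m
      map_add' := fun _ _ => rfl
      map_smul' := fun _ _ => rfl }
  exact (l.isSemisimpleModule_iff_of_bijective Function.bijective_id).mpr inferInstance

variable [FiniteDimensional k C] [Module.Finite Cᵐᵒᵖ M]

/-- A semisimple `τ_C`-rigid module `M` with `Hom_C(M ⊗_C E, M) = 0` is `τ_B`-rigid. -/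
theorem isTauRigid_inflation [IsSemisimpleModule Cᵐᵒᵖ M] (hM : IsTauRigid k C M)
    (hE : ∀ μ : M →+ RelBimodule k C →+ M, IsTensorHom μ → ∀ m e, μ m e = 0) :
    IsTauRigid k (RelExt k C) (Inflation k C M) := by
  refine isTauRigid_of_exists_extend k (RelExt k C) fun h => ?_
  let P := (projCover k (RelExt k C)ᵐᵒᵖ (Inflation k C M)).P
  let π : P →ₗ[(RelExt k C)ᵐᵒᵖ] Inflation k C M := (projCover k (RelExt k C)ᵐᵒᵖ (Inflation k C M)).f
  have hπ : Function.Surjective π := (projCover k (RelExt k C)ᵐᵒᵖ (Inflation k C M)).isCover.2.1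
  change LinearMap.ker π →ₗ[(RelExt k C)ᵐᵒᵖ] Inflation k C M at h
  change ∃ t : P →ₗ[(RelExt k C)ᵐᵒᵖ] Inflation k C M, ∀ x : LinearMap.ker π, t x = h x
  -- C acts on P through the section c ↦ (c, 0) of B → C.
  let _ : Module Cᵐᵒᵖ P :=
    Module.compHom P (TrivSqZeroExt.inlHom C (RelBimodule k C)).op
  have hinl : ∀ (c : C) (p : P), op c • p = op (TrivSqZeroExt.inl c : RelExt k C) • p :=
    fun _ _ => rfl
  have hE0 : ∀ (e : RelBimodule k C) (m : Inflation k C M),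
      op (TrivSqZeroExt.inr e : RelExt k C) • m = 0 := fun e m =>
    zero_smul Cᵐᵒᵖ (show M from m)
  have hmem : ∀ (e : RelBimodule k C) (p : P),
      op (TrivSqZeroExt.inr e : RelExt k C) • p ∈ LinearMap.ker π := fun e p => by
    rw [LinearMap.mem_ker, map_smul, hE0]
  -- the pairing of `P` with `E`
  let ν : P →+ RelBimodule k C →+ M := AddMonoidHom.mk' (fun p => AddMonoidHom.mk'
    (fun e => (show M from h ⟨op (TrivSqZeroExt.inr e : RelExt k C) • p, hmem e p⟩))
    (fun e e' => by
      refine (congrArg h (Subtype.ext ?_)).trans (map_add h ⟨_, hmem e p⟩ ⟨_, hmem e' p⟩)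
      change op (TrivSqZeroExt.inr (e + e') : RelExt k C) • p = _ • p + _ • p
      rw [TrivSqZeroExt.inr_add, MulOpposite.op_add, add_smul]))
    (fun p p' => by
      ext e
      exact (congrArg h (Subtype.ext (smul_add _ _ _))).trans
        (map_add h ⟨_, hmem e p⟩ ⟨_, hmem e p'⟩))
  have hν : ∀ p e, ν p e = h ⟨op (TrivSqZeroExt.inr e : RelExt k C) • p, hmem e p⟩ :=
    fun _ _ => rfl
  -- For p in ker π, h(p e) = h(p) e = 0, so the pairing depends only on π p and descends to M.
  have hνK : ∀ p, π p = 0 → ∀ e, ν p e = 0 := fun p hp e => by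
    have : h ⟨op (TrivSqZeroExt.inr e : RelExt k C) • p, hmem e p⟩ =
      op (TrivSqZeroExt.inr e : RelExt k C) • h ⟨p, hp⟩ :=
      (congrArg h (Subtype.ext rfl)).trans (map_smul h _ ⟨p, hp⟩)
    rw [hν, this, hE0]; rfl
  have hνeq : ∀ p q, π p = π q → ν p = ν q := fun p q hpq => by
    rw [← sub_eq_zero, ← map_sub]
    ext e
    exact hνK _ (by rw [map_sub, hpq, sub_self]) e
  -- A merely set-theoretic section suffices, since the pairing depends only on the image in M.
  let σ : M → P := fun m => Function.surjInv hπ (show Inflation k C M from m)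
  have hσ : ∀ m : M, π (σ m) = m := fun m => Function.surjInv_eq hπ _
  let μ : M →+ RelBimodule k C →+ M := AddMonoidHom.mk' (fun m => ν (σ m)) fun m m' => by
    rw [← map_add]
    refine hνeq _ _ ?_
    rw [map_add, hσ, hσ, hσ]; rfl
  have hμν : ∀ p, μ (π p) = ν p := fun p => hνeq _ _ (hσ _)
  have hμ : IsTensorHom μ := by
    constructor
    · intro c m e
      have h1 : μ (op c • m) = ν (op c • σ m) := by
        refine hνeq _ _ ?_
        rw [hσ, hinl, map_smul, hσ]; rfl
      rw [h1]
      change ν _ _ = ν _ _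
      rw [hν, hν]
      congr 1
      refine Subtype.ext ?_
      change op (TrivSqZeroExt.inr e : RelExt k C) • op (TrivSqZeroExt.inl c : RelExt k C) • σ m
        = op (TrivSqZeroExt.inr (c • e) : RelExt k C) • σ m
      rw [smul_smul, ← op_mul, TrivSqZeroExt.inl_mul_inr]
    · intro c m e
      change ν _ _ = op c • ν _ _
      rw [hν, hν]
      have : ∀ x : LinearMap.ker π, (op c • (show M from h x) : M) =
          h (op (TrivSqZeroExt.inl c : RelExt k C) • x) := fun x => by rw [map_smul]; rfl
      refine Eq.trans ?_ (this _).symm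
      congr 1
      refine Subtype.ext ?_
      change op (TrivSqZeroExt.inr (op c • e) : RelExt k C) • σ m =
        op (TrivSqZeroExt.inl c : RelExt k C) • op (TrivSqZeroExt.inr e : RelExt k C) • σ m
      rw [smul_smul, ← op_mul, TrivSqZeroExt.inr_mul_inl]
  have hν0 : ∀ p e, ν p e = 0 := fun p e => by rw [← hμν]; exact hE μ hμ _ _
  let πC : P →ₗ[Cᵐᵒᵖ] M :=
    { toFun := fun p => π p
      map_add' := map_add π
      map_smul' := fun c p => map_smul π (op (TrivSqZeroExt.inl c.unop : RelExt k C)) p }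
  let hC : LinearMap.ker πC →ₗ[Cᵐᵒᵖ] M :=
    { toFun := fun x => h ⟨x.1, x.2⟩
      map_add' := fun x y => map_add h ⟨x.1, x.2⟩ ⟨y.1, y.2⟩
      map_smul' := fun c x => map_smul h (op (TrivSqZeroExt.inl c.unop : RelExt k C)) ⟨x.1, x.2⟩ }
  -- P need not be projective over C, so the extension property is needed for an arbitrary
  -- surjection onto M.
  obtain ⟨t, ht⟩ := hM.exists_extend k C πC hπ hC
  refine ⟨{ toFun := fun p => t p
            map_add' := map_add t
            map_smul' := fun b p => ?_ }, fun x => ht ⟨x.1, x.2⟩⟩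
  have hb : b = op (TrivSqZeroExt.inl b.unop.fst : RelExt k C) +
      op (TrivSqZeroExt.inr b.unop.snd : RelExt k C) := by
    rw [← MulOpposite.op_add, TrivSqZeroExt.inl_fst_add_inr_snd_eq, op_unop]
  -- On PE, which lies in ker π, t agrees with h and so vanishes; C-linearity then gives
  -- B-linearity.
  have h1 : t (op (TrivSqZeroExt.inr b.unop.snd : RelExt k C) • p) = 0 :=
    (ht ⟨_, hmem _ p⟩).trans (hν0 p _)
  have h2 : t (op (TrivSqZeroExt.inl b.unop.fst : RelExt k C) • p) = op b.unop.fst • t p :=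
    map_smul t (op b.unop.fst) p
  change t (b • p) = op b.unop.fst • t p
  rw [← h2]
  conv_lhs => rw [hb, add_smul, map_add, h1, add_zero]

end RelationExtensionRigidity

/-! ### Yoneda products with spliced classes in Ext² -/

section DoubleExtension

open Abelian

variable {𝒞 : Type u} [Category.{v} 𝒞] [Abelian 𝒞] [HasExt.{w} 𝒞]
variable {X₁ X₂ X₃ X₄ X₅ : 𝒞} {f₁ : X₁ ⟶ X₂} {g₁ : X₂ ⟶ X₃} {w₁ : f₁ ≫ g₁ = 0}
  {f₂ : X₃ ⟶ X₄} {g₂ : X₄ ⟶ X₅} {w₂ : f₂ ≫ g₂ = 0}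
  (h₁ : (ShortComplex.mk f₁ g₁ w₁).ShortExact) (h₂ : (ShortComplex.mk f₂ g₂ w₂).ShortExact)

/-- The class in `Ext²(X₅, X₁)` of a spliced exact sequence `X₁ → X₂ → X₄ → X₅`. -/
noncomputable def spliceClass : Ext.{w} X₅ X₁ 2 := h₂.extClass.comp h₁.extClass rfl

/-- Two dimension shifts: Ext²(Z, X₂) = 0 lifts ξ to Ext¹(Z, X₃), and Ext¹(Z, X₄) = 0 lifts that to
Hom(Z, X₅). -/
theorem comp_spliceClass_surjective [Injective X₂] [Injective X₄] {Z : 𝒞} (ξ : Ext.{w} Z X₁ 2) :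
    ∃ ψ : Z ⟶ X₅, (Ext.mk₀ ψ).comp (spliceClass h₁ h₂) (zero_add 2) = ξ := by
  obtain ⟨η, hη⟩ := Ext.covariant_sequence_exact₁ Z h₁ ξ (Ext.eq_zero_of_injective _)
    (show 1 + 1 = 2 from rfl)
  obtain ⟨ζ, hζ⟩ := Ext.covariant_sequence_exact₁ Z h₂ η (Ext.eq_zero_of_injective _)
    (show 0 + 1 = 1 from rfl)
  obtain ⟨ψ, rfl⟩ := Ext.addEquiv₀.symm.surjective ζ
  refine ⟨ψ, ?_⟩
  rw [← hη, ← hζ, spliceClass]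
  exact (Ext.comp_assoc _ _ _ _ _ (by lia)).symm

/-- The class of the second sequence pulls back to zero along g₂. This yields the relations that
define the cokernel in the transpose. -/
theorem comp_spliceClass_eq_zero {Z : 𝒞} (θ : Z ⟶ X₄) :
    (Ext.mk₀ (θ ≫ g₂)).comp (spliceClass h₁ h₂) (zero_add 2) = 0 := by
  have h : (Ext.mk₀ g₂).comp h₂.extClass (zero_add 1) = 0 := h₂.comp_extClass
  rw [← Ext.mk₀_comp_mk₀_assoc, spliceClass,
    ← Ext.comp_assoc (Ext.mk₀ g₂) h₂.extClass h₁.extClass (zero_add 1) rfl (by lia), h,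
    Ext.zero_comp, Ext.comp_zero]

/-- The dual dimension shift, through Ext²(X₄, Z) = 0 and Ext¹(X₂, Z) = 0. -/
theorem spliceClass_comp_surjective [Projective X₂] [Projective X₄] {Z : 𝒞} (ξ : Ext.{w} X₅ Z 2) :
    ∃ ψ : X₁ ⟶ Z, (spliceClass h₁ h₂).comp (Ext.mk₀ ψ) (add_zero 2) = ξ := by
  obtain ⟨η, hη⟩ := Ext.contravariant_sequence_exact₃ h₂ Z ξ (Ext.eq_zero_of_projective _)
    (show 1 + 1 = 2 from rfl)
  obtain ⟨ζ, hζ⟩ := Ext.contravariant_sequence_exact₃ h₁ Z η (Ext.eq_zero_of_projective _)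
    (show 1 + 0 = 1 from rfl)
  obtain ⟨ψ, rfl⟩ := Ext.addEquiv₀.symm.surjective ζ
  refine ⟨ψ, ?_⟩
  rw [← hη, ← hζ, spliceClass]
  exact Ext.comp_assoc _ _ _ _ _ (by lia)

theorem spliceClass_comp_eq_zero {Z : 𝒞} (θ : X₂ ⟶ Z) :
    (spliceClass h₁ h₂).comp (Ext.mk₀ (f₁ ≫ θ)) (add_zero 2) = 0 := by
  have h : h₁.extClass.comp (Ext.mk₀ f₁) (add_zero 1) = 0 := h₁.extClass_comp
  rw [← Ext.mk₀_comp_mk₀,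
    ← Ext.comp_assoc (spliceClass h₁ h₂) (Ext.mk₀ f₁) (Ext.mk₀ θ) (add_zero 2) (zero_add 0)
      (by lia),
    spliceClass, Ext.comp_assoc h₂.extClass h₁.extClass (Ext.mk₀ f₁) rfl (add_zero 1) (by lia), h,
    Ext.comp_zero, Ext.zero_comp]

/-- If the middle terms of a spliced exact sequence are injective, then `Ext¹(Z, X₅)` embeds into
`Ext³(Z, X₁)`. -/
theorem ext_one_eq_zero [Injective X₂] [Injective X₄] {Z : 𝒞} [HasProjectiveDimensionLT Z 3]
    (h₁ : (ShortComplex.mk f₁ g₁ w₁).ShortExact) (h₂ : (ShortComplex.mk f₂ g₂ w₂).ShortExact)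
    (η : Ext.{w} Z X₅ 1) : η = 0 := by
  -- The product lies in Ext²(Z, X₃), which embeds into Ext³(Z, X₁) = 0.
  have h0 : η.comp h₂.extClass (show 1 + 1 = 2 from rfl) = 0 := by
    obtain ⟨ζ, hζ⟩ := Ext.covariant_sequence_exact₃ Z h₁ (η.comp h₂.extClass rfl)
      (show 2 + 1 = 3 from rfl) (Ext.eq_zero_of_hasProjectiveDimensionLT _ 3 le_rfl)
    rw [← hζ, ζ.eq_zero_of_injective, Ext.zero_comp]
  obtain ⟨ζ, hζ⟩ := Ext.covariant_sequence_exact₃ Z h₂ η _ h0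
  rw [← hζ, ζ.eq_zero_of_injective, Ext.zero_comp]

end DoubleExtension

/-! ### Duality between left and right modules -/

section DualModules

variable {k C : Type u} [Field k] [Ring C] [Algebra k C]

/-- The map `N → D C` of right modules that corresponds to a linear functional on `N`. -/
def toDual {N : Type u} [AddCommGroup N] [Module k N] [Module Cᵐᵒᵖ N] [IsScalarTower k Cᵐᵒᵖ N]
    (l : N →ₗ[k] k) : N →ₗ[Cᵐᵒᵖ] D k C where
  toFun z := (show C →ₗ[k] k from
    { toFun := fun c => l (op c • z)
      map_add' := fun c c' => by rw [MulOpposite.op_add, add_smul, map_add]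
      map_smul' := fun a c => by rw [op_smul, smul_assoc, map_smul, RingHom.id_apply] })
  map_add' z z' := D.ext fun c => by
    change l (op c • (z + z')) = l (op c • z) + l (op c • z')
    rw [smul_add, map_add]
  map_smul' a z := D.ext fun c => by
    change l (op c • a • z) = l (op (a.unop * c) • z)
    rw [smul_smul]; rfl

theorem toDual_apply {N : Type u} [AddCommGroup N] [Module k N] [Module Cᵐᵒᵖ N]
    [IsScalarTower k Cᵐᵒᵖ N] (l : N →ₗ[k] k) (z : N) (c : C) :
    toDual l z c = l (op c • z) := rfl

variable {N K X : Type u} [AddCommGroup N] [Module k N] [Module C N] [IsScalarTower k C N]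
  [AddCommGroup K] [Module k K] [Module C K] [IsScalarTower k C K]
  [AddCommGroup X] [Module k X] [Module Cᵐᵒᵖ X] [IsScalarTower k Cᵐᵒᵖ X]

/-- Every map `D N → D K` of right modules is dual to a map `K → N` of left modules. -/
theorem exists_eq_dual [FiniteDimensional k N] (v : D k N →ₗ[Cᵐᵒᵖ] D k K) :
    ∃ φ : K →ₗ[C] N, ∀ ψ x, v ψ x = ψ (φ x) := by
  -- By reflexivity of N, the functional ψ ↦ v ψ x is evaluation at a unique element, which is φ x.
  let E : N ≃ₗ[k] Module.Dual k (Module.Dual k N) := Module.evalEquiv k N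
  have hvk : ∀ (a : k) (ψ : D k N), v (a • ψ) = a • v ψ := fun a ψ => by
    rw [← algebraMap_smul Cᵐᵒᵖ a ψ, map_smul, algebraMap_smul]
  let F : K → Module.Dual k (Module.Dual k N) := fun x =>
    { toFun := fun ψ => v ψ x
      map_add' := fun ψ ψ' => by
        have : v (ψ + ψ') = v ψ + v ψ' := map_add v ψ ψ'
        exact congrArg (fun χ : D k K => χ x) this
      map_smul' := fun a ψ => congrArg (fun χ : D k K => χ x) (hvk a ψ) }
  have hF : ∀ x ψ, (show D k N from ψ) (E.symm (F x)) = v ψ x := fun x ψ =>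
    LinearMap.congr_fun (E.apply_symm_apply (F x)) ψ
  have hinj : ∀ c c' : N, (∀ ψ : D k N, ψ c = ψ c') → c = c' := fun c c' h =>
    E.injective (LinearMap.ext h)
  refine ⟨{ toFun := fun x => E.symm (F x)
            map_add' := fun x y => hinj _ _ fun ψ => ?_
            map_smul' := fun c x => hinj _ _ fun ψ => ?_ }, fun ψ x => (hF x ψ).symm⟩
  · rw [hF, map_add, map_add, hF, hF]
  · have := hF x (op c • ψ)
    rw [map_smul] at this
    exact (hF _ ψ).trans this.symm

/-- The dual of a map of left modules. -/
noncomputable def dualMap (f : K →ₗ[C] N) : D k N →ₗ[Cᵐᵒᵖ] D k K where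
  toFun ψ := (show N →ₗ[k] k from ψ) ∘ₗ f.restrictScalars k
  map_add' _ _ := rfl
  map_smul' a ψ := D.ext fun x => congrArg ψ (map_smul f a.unop x).symm

theorem dualMap_apply (f : K →ₗ[C] N) (ψ : D k N) (x : K) : dualMap f ψ x = ψ (f x) := rfl

/-- The map `X → D N` that corresponds to a map `N → D X`. -/
noncomputable def transpose (G : N →ₗ[C] D k X) : X →ₗ[Cᵐᵒᵖ] D k N where
  toFun x := (show N →ₗ[k] k from
    { toFun := fun p => G p x
      map_add' := fun p p' => by rw [map_add, D.add_apply]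
      map_smul' := fun a p => by
        rw [← algebraMap_smul C a p, map_smul, algebraMap_smul]; rfl })
  map_add' x x' := D.ext fun p => map_add (G p) x x'
  map_smul' a x := D.ext fun p => by
    change G p (a • x) = G (a.unop • p) x
    rw [map_smul G]; rfl

theorem D.eq_of_forall_apply_eq {V : Type u} [AddCommGroup V] [Module k V] {x y : V}
    (h : ∀ ψ : D k V, ψ x = ψ y) : x = y := by
  rw [← sub_eq_zero, ← Module.forall_dual_apply_eq_zero_iff k]
  intro ψ
  rw [map_sub, sub_eq_zero]
  exact h ψ

/-- Linear functionals extend along injective linear maps. -/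
theorem D.exists_extend {V V' : Type u} [AddCommGroup V] [Module k V] [AddCommGroup V']
    [Module k V'] (f : V →ₗ[k] V') (hf : Function.Injective f) (ψ : D k V) :
    ∃ ψ' : D k V', ∀ x, ψ' (f x) = ψ x := by
  obtain ⟨e, he⟩ := LinearMap.exists_leftInverse_of_injective f (LinearMap.ker_eq_bot.mpr hf)
  refine ⟨(show V' →ₗ[k] k from (show V →ₗ[k] k from ψ) ∘ₗ e), fun x => ?_⟩
  exact congrArg ψ (LinearMap.congr_fun he x)

/-- The dual of a projective left module is an injective right module. -/
theorem injective_dual_of_projective [Module.Projective C N] :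
    Module.Injective Cᵐᵒᵖ (D k N) where
  out X Y _ _ _ _ f hf g := by
    let _ : Module k X := Module.compHom X (algebraMap k Cᵐᵒᵖ)
    let _ : Module k Y := Module.compHom Y (algebraMap k Cᵐᵒᵖ)
    have : IsScalarTower k Cᵐᵒᵖ X := ⟨fun a s x => by
      rw [Algebra.smul_def, mul_smul]; rfl⟩
    have : IsScalarTower k Cᵐᵒᵖ Y := ⟨fun a s x => by
      rw [Algebra.smul_def, mul_smul]; rfl⟩
    have hgk : ∀ (a : k) x, g (a • x) = a • g x := fun a x => by
      rw [← algebraMap_smul Cᵐᵒᵖ a x, map_smul, algebraMap_smul]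
    -- By transposition, extending g along f amounts to lifting G : N → DX along the surjective
    -- restriction R : DY → DX.
    let G : N →ₗ[C] D k X :=
      { toFun := fun p => (show X →ₗ[k] k from
          { toFun := fun x => g x p
            map_add' := fun x y => by rw [map_add, D.add_apply]
            map_smul' := fun a x => by rw [hgk]; rfl })
        map_add' := fun p p' => D.ext fun x => map_add (g x) p p'
        map_smul' := fun c p => D.ext fun x => by
          change g x (c • p) = g (op c • x) p
          rw [map_smul g]; rfl }
    let R : D k Y →ₗ[C] D k X :=
      { toFun := fun ψ => (show X →ₗ[k] k from
          (show Y →ₗ[k] k from ψ) ∘ₗ f.restrictScalars k)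
        map_add' := fun _ _ => rfl
        map_smul' := fun c ψ => D.ext fun x => congrArg ψ (map_smul f (op c) x).symm }
    have hR : Function.Surjective R := fun ψ => by
      obtain ⟨ψ', h⟩ := D.exists_extend (f.restrictScalars k) hf ψ
      exact ⟨ψ', D.ext h⟩
    obtain ⟨H, hH⟩ := Module.projective_lifting_property R G hR
    refine ⟨transpose H, fun x => D.ext fun p => ?_⟩
    exact congrArg (fun ψ : D k X => ψ x) (LinearMap.congr_fun hH p)

/-- A finitely generated left module with injective dual is projective. -/
theorem projective_of_injective_dual [FiniteDimensional k C] [Module.Finite C K]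
    (hK : Module.Injective Cᵐᵒᵖ (D k K)) : Module.Projective C K := by
  obtain ⟨n, π, hπ⟩ := Module.Finite.exists_fin' C K
  have hinj : Function.Injective (dualMap (k := k) π) := fun ψ ψ' h => D.ext fun x => by
    obtain ⟨y, rfl⟩ := hπ x
    exact congrArg (fun χ : D k (Fin n → C) => χ y) h
  -- The dual of a free presentation splits; the retraction s is itself dual to a map φ, which is a
  -- section of π.
  obtain ⟨s, hs⟩ := hK.out (dualMap π) hinj LinearMap.id
  obtain ⟨φ, hφ⟩ := exists_eq_dual s
  refine Module.Projective.of_split φ π (LinearMap.ext fun x => ?_)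
  refine D.eq_of_forall_apply_eq (k := k) fun ψ => ?_
  change ψ (π (φ x)) = ψ x
  rw [← dualMap_apply, ← hφ, hs]; rfl

end DualModules

/-! ### Part (b): Ext²(I₀, C) and τΩI₀ -/

section InjectiveEnvelope

open Abelian

variable {k C : Type u} [Field k] [Ring C] [Algebra k C]

/-- The left action of an element of `C` on `D C`, in terms of a map of left modules `C → C`. -/
theorem ofHom_eq_dualLeftHom (v : D k C →ₗ[Cᵐᵒᵖ] D k C) (φ : C →ₗ[C] C)
    (h : ∀ ψ x, v ψ x = ψ (φ x)) : ModuleCat.ofHom v = dualLeftHom k (φ 1) := by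
  refine ModuleCat.hom_ext (LinearMap.ext fun ψ => D.ext fun a => ?_)
  change v ψ a = ψ (a * φ 1)
  rw [h, ← smul_eq_mul, ← map_smul, smul_eq_mul, mul_one]

/-- The second extension group as a quotient of the dual of a projective second syzygy. -/
theorem exists_surjective_ext_two {N P Q P₂ : Type u} [AddCommGroup N] [Module Cᵐᵒᵖ N]
    [AddCommGroup P] [Module Cᵐᵒᵖ P] [Module.Projective Cᵐᵒᵖ P]
    [AddCommGroup Q] [Module Cᵐᵒᵖ Q] [Module.Projective Cᵐᵒᵖ Q]
    [AddCommGroup P₂] [Module Cᵐᵒᵖ P₂]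
    (p : P →ₗ[Cᵐᵒᵖ] N) (hp : Function.Surjective p)
    (p' : Q →ₗ[Cᵐᵒᵖ] LinearMap.ker p) (hp' : Function.Surjective p')
    (q : P₂ ≃ₗ[Cᵐᵒᵖ] LinearMap.ker p') :
    ∃ Ψ : (P₂ →ₗ[Cᵐᵒᵖ] C) →ₗ[k] Ext.{u} (ModuleCat.of Cᵐᵒᵖ N) (ModuleCat.of Cᵐᵒᵖ C) 2,
      Function.Surjective Ψ ∧
      (∀ (a : C) φ, Ψ (a • φ) = (Ψ φ).comp (Ext.mk₀ (mulLeftHom a)) (add_zero 2)) ∧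
      ∀ θ : Q →ₗ[Cᵐᵒᵖ] C, Ψ (θ ∘ₗ (LinearMap.ker p').subtype ∘ₗ q.toLinearMap) = 0 := by
  have p₀ := (IsProjective.iff_projective (R := Cᵐᵒᵖ) P).mp inferInstance
  have p₁ := (IsProjective.iff_projective (R := Cᵐᵒᵖ) Q).mp inferInstance
  have s₀ := LinearMap.shortExact_shortComplexKer hp
  have s₁ := LinearMap.shortExact_shortComplexKer hp'
  -- The class of ker p' → Q → P → N. Composition with it is onto because P and Q are projective,
  -- and it kills maps that extend to Q.
  let δ : Ext.{u} (ModuleCat.of Cᵐᵒᵖ N) (ModuleCat.of Cᵐᵒᵖ (LinearMap.ker p')) 2 :=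
    spliceClass s₁ s₀
  refine ⟨
    { toFun := fun φ => δ.comp (Ext.mk₀ (ModuleCat.ofHom (φ ∘ₗ q.symm.toLinearMap))) (add_zero 2)
      map_add' := fun φ φ' => by
        rw [← Ext.comp_add, ← Ext.mk₀_add]; rfl
      map_smul' := fun a φ => by
        rw [RingHom.id_apply, ← Ext.comp_smul]
        congr 1
        exact mk₀_eq_smul k a _ _ fun z => (algebraMap_smul Cᵐᵒᵖ a (φ (q.symm z))).symm },
    fun ξ => ?_, fun a φ => ?_, fun θ => ?_⟩
  · obtain ⟨ψ, hψ⟩ := spliceClass_comp_surjective s₁ s₀ ξ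
    refine ⟨ψ.hom ∘ₗ q.toLinearMap, ?_⟩
    rw [← hψ]
    change δ.comp (Ext.mk₀ _) (add_zero 2) = δ.comp (Ext.mk₀ _) (add_zero 2)
    congr 2
    ext z
    change ψ.hom (q (q.symm z)) = _
    rw [q.apply_symm_apply]
  · change δ.comp _ (add_zero 2) = Ext.comp (δ.comp _ (add_zero 2)) _ (add_zero 2)
    rw [Ext.comp_assoc_of_second_deg_zero, Ext.mk₀_comp_mk₀]; rfl
  · refine Eq.trans ?_ (spliceClass_comp_eq_zero s₁ s₀ (ModuleCat.ofHom θ))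
    change δ.comp (Ext.mk₀ _) (add_zero 2) = δ.comp (Ext.mk₀ _) (add_zero 2)
    congr 2
    ext z
    change θ ((q (q.symm z)).1) = _
    rw [q.apply_symm_apply]; rfl

variable [FiniteDimensional k C]

/-- In global dimension at most two, the second syzygy in a minimal projective resolution is
projective. -/
theorem projective_syzygy_syzygy (hC : GlobalDimLE C 2) (N : Type u) [AddCommGroup N]
    [Module Cᵐᵒᵖ N] [Module.Finite Cᵐᵒᵖ N] :
    Module.Projective Cᵐᵒᵖ (syzygy k Cᵐᵒᵖ (syzygy k Cᵐᵒᵖ N)) := by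
  have h₀ := (projCover k Cᵐᵒᵖ N).isCover
  have h₁ := (projCover k Cᵐᵒᵖ (syzygy k Cᵐᵒᵖ N)).isCover
  have p₀ := (IsProjective.iff_projective _).mp h₀.1
  have p₁ := (IsProjective.iff_projective _).mp h₁.1
  -- The strict bound 3 is written 1 + 2 to match the n + 2 of the syzygy shift; two shifts bring it
  -- down to 1, which means projective.
  have d₀ : HasProjectiveDimensionLT (ModuleCat.of Cᵐᵒᵖ N) (1 + 2) := hC (ModuleCat.of Cᵐᵒᵖ N) ‹_›
  have d₁ := ((LinearMap.shortExact_shortComplexKer h₀.2.1).hasProjectiveDimensionLT_X₃_iff 1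
    p₀).mp d₀
  have d₂ := ((LinearMap.shortExact_shortComplexKer h₁.2.1).hasProjectiveDimensionLT_X₃_iff 0
    p₁).mp d₁
  exact (IsProjective.iff_projective _).mpr (projective_iff_hasProjectiveDimensionLT_one.mpr d₂)

/-- If `M` embeds into the injective module `I₀`, and there is no nonzero map from `M` to the dual
of a quotient `V / W` that maps onto `Ext²(I₀, C)`, then `Hom_C(M ⊗_C E, M) = 0`. -/
theorem IsTensorHom.eq_zero_of_surjective
    {M : Type u} [AddCommGroup M] [Module Cᵐᵒᵖ M]
    {I₀ : Type u} [AddCommGroup I₀] [Module Cᵐᵒᵖ I₀] [Module.Finite Cᵐᵒᵖ I₀]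
    (hI : Module.Injective Cᵐᵒᵖ I₀) (g : M →ₗ[Cᵐᵒᵖ] I₀) (hg : Function.Injective g)
    {V : Type u} [AddCommGroup V] [Module k V] [Module C V] [IsScalarTower k C V]
    (W : Submodule C V) (Ψ : V →ₗ[k] Ext.{u} (ModuleCat.of Cᵐᵒᵖ I₀) (ModuleCat.of Cᵐᵒᵖ C) 2)
    (hΨs : Function.Surjective Ψ)
    (hΨ : ∀ (a : C) v, Ψ (a • v) = (Ψ v).comp (Ext.mk₀ (mulLeftHom a)) (add_zero 2))
    (hW : ∀ w ∈ W, Ψ w = 0) (hM : ∀ h : M →ₗ[Cᵐᵒᵖ] D k (V ⧸ W), h = 0)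
    {μ : M →+ RelBimodule k C →+ M} (hμ : IsTensorHom μ) (m : M) (e : RelBimodule k C) :
    μ m e = 0 := by
  let _ : Module k I₀ := Module.compHom I₀ (algebraMap k Cᵐᵒᵖ)
  have _ : IsScalarTower k Cᵐᵒᵖ I₀ := ⟨fun a s x => by
    rw [Algebra.smul_def, mul_smul]; rfl⟩
  have : Module.Finite k I₀ := Module.Finite.trans Cᵐᵒᵖ I₀
  -- `I₀` is a direct summand of a power of `D C`
  let b := Module.finBasis k I₀
  let x : Fin (Module.finrank k I₀) → I₀ →ₗ[Cᵐᵒᵖ] D k C := fun i => toDual (b.coord i)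
  have hx1 : ∀ i z, x i z 1 = b.coord i z := fun i z => by
    rw [toDual_apply, op_one, one_smul]
  have hinj : Function.Injective (LinearMap.pi x) := fun z z' h => b.ext_elem fun i => by
    have := congrArg (fun F => F i (1 : C)) h
    rwa [LinearMap.pi_apply, LinearMap.pi_apply, hx1, hx1] at this
  obtain ⟨r, hr⟩ := hI.out (LinearMap.pi x) hinj LinearMap.id
  let y : Fin (Module.finrank k I₀) → D k C →ₗ[Cᵐᵒᵖ] I₀ := fun i =>
    r ∘ₗ LinearMap.single Cᵐᵒᵖ (fun _ => D k C) i
  have hyx : ∀ z, ∑ i, y i (x i z) = z := fun z => by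
    conv_rhs => rw [← LinearMap.id_apply (R := Cᵐᵒᵖ) z, ← hr z,
      ← Finset.univ_sum_single (LinearMap.pi x z), map_sum]
    rfl
  -- the functional on `Ext²(I₀, C)` attached to an element of `M`
  let ρ : Fin (Module.finrank k I₀) → Ext.{u} (ModuleCat.of Cᵐᵒᵖ I₀) (ModuleCat.of Cᵐᵒᵖ C) 2 →
      RelBimodule k C := fun i ξ => (Ext.mk₀ (ModuleCat.ofHom (y i))).comp ξ (zero_add 2)
  have hμk : ∀ z (a : k) e i, x i (g (μ z (a • e))) 1 = a * x i (g (μ z e)) 1 := by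
    intro z a e i
    rw [← algebraMap_smul Cᵐᵒᵖ a e]
    have h1 : algebraMap k Cᵐᵒᵖ a = op (algebraMap k C a) := rfl
    rw [h1, hμ.2, map_smul, map_smul, D.op_smul_apply, unop_op, algebraMap_smul, map_smul,
      smul_eq_mul]
  let T : M → Ext.{u} (ModuleCat.of Cᵐᵒᵖ I₀) (ModuleCat.of Cᵐᵒᵖ C) 2 →ₗ[k] k := fun z =>
    { toFun := fun ξ => ∑ i, x i (g (μ z (ρ i ξ))) 1
      map_add' := fun ξ ξ' => by
        rw [← Finset.sum_add_distrib]
        refine Finset.sum_congr rfl fun i _ => ?_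
        have : ρ i (ξ + ξ') = ρ i ξ + ρ i ξ' := Ext.comp_add _ _ _ _
        rw [this, map_add, map_add, map_add, D.add_apply]
      map_smul' := fun a ξ => by
        rw [RingHom.id_apply, smul_eq_mul, Finset.mul_sum]
        refine Finset.sum_congr rfl fun i _ => ?_
        have : ρ i (a • ξ) = a • ρ i ξ := Ext.comp_smul _ _ _ _
        rw [this, hμk] }
  have hT : ∀ z ξ, T z ξ = ∑ i, x i (g (μ z (ρ i ξ))) 1 := fun _ _ => rfl
  -- T z ∘ Ψ vanishes on W and is compatible with the C-actions, so it defines a map M → D(V / W).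
  -- This map is zero, and since Ψ is onto, T = 0.
  obtain ⟨χ, hχ⟩ := exists_hom_dual_quotient (k := k) W (fun z => T z ∘ₗ Ψ)
    (fun z z' v => by
      simp only [LinearMap.comp_apply, hT]
      rw [← Finset.sum_add_distrib]
      refine Finset.sum_congr rfl fun i _ => ?_
      rw [map_add, AddMonoidHom.add_apply, map_add, map_add, D.add_apply])
    (fun a z v => by
      simp only [LinearMap.comp_apply, hT]
      refine Finset.sum_congr rfl fun i _ => ?_
      have : ρ i (Ψ (a • v)) = a • ρ i (Ψ v) := by
        rw [hΨ]
        exact (Ext.comp_assoc_of_third_deg_zero _ _ _ _).symm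
      rw [this, hμ.1])
    (fun z w hw => by rw [LinearMap.comp_apply, hW w hw, map_zero])
  have hT0 : ∀ z ξ, T z ξ = 0 := fun z ξ => by
    obtain ⟨v, rfl⟩ := hΨs ξ
    refine (hχ z v).symm.trans ?_
    rw [hM χ]; rfl
  refine hg ((b.ext_elem fun j => ?_).trans (map_zero g).symm)
  rw [map_zero, Finsupp.zero_apply]
  change b.coord j (g (μ m e)) = 0
  -- Pulling e back along xⱼ yields a class at which T m is the j-th coordinate of g(μ m e): xⱼ ∘ yᵢ
  -- is the action of some c in C, so ρᵢ returns e c, and ∑ yᵢ xᵢ = 1.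
  rw [← hx1, ← hyx (g (μ m e)), map_sum,
    ← hT0 m ((Ext.mk₀ (ModuleCat.ofHom (x j))).comp e.toExt (zero_add 2)), hT]
  refine (map_sum (AddMonoidHom.mk' (fun F : D k C => F (1 : C)) fun _ _ => rfl) _ _).trans ?_
  refine Finset.sum_congr rfl fun i _ => ?_
  obtain ⟨φ, hφ⟩ := exists_eq_dual (x j ∘ₗ y i)
  have h1 : ρ i ((Ext.mk₀ (ModuleCat.ofHom (x j))).comp e.toExt (zero_add 2)) =
      op (φ 1) • e := by
    change Ext.comp _ (Ext.comp _ _ _) _ = extRight (φ 1) e.toExt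
    rw [Ext.mk₀_comp_mk₀_assoc, extRight, ← ofHom_eq_dualLeftHom (x j ∘ₗ y i) φ hφ]
    rfl
  rw [h1, hμ.2, map_smul, map_smul, D.op_smul_apply, unop_op, smul_eq_mul, mul_one]
  exact hφ _ _

/-- If `M` embeds into the injective module `I₀` and `Hom_C(M, τ Ω I₀) = 0`, then
`Hom_C(M ⊗_C E, M) = 0`. -/
theorem IsTensorHom.eq_zero_of_hom_tau_syzygy (hC : GlobalDimLE C 2)
    {M : Type u} [AddCommGroup M] [Module Cᵐᵒᵖ M]
    {I₀ : Type u} [AddCommGroup I₀] [Module Cᵐᵒᵖ I₀] [Module.Finite Cᵐᵒᵖ I₀]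
    (hI : Module.Injective Cᵐᵒᵖ I₀) (g : M →ₗ[Cᵐᵒᵖ] I₀) (hg : Function.Injective g)
    (hM : ∀ h : M →ₗ[Cᵐᵒᵖ] tau k C (syzygy k Cᵐᵒᵖ I₀), h = 0)
    {μ : M →+ RelBimodule k C →+ M} (hμ : IsTensorHom μ) (m : M) (e : RelBimodule k C) :
    μ m e = 0 := by
  have c₀ := (projCover k Cᵐᵒᵖ I₀).isCover
  have c₁ := (projCover k Cᵐᵒᵖ (syzygy k Cᵐᵒᵖ I₀)).isCover
  have := c₀.1
  have := c₁.1
  -- Projectivity makes the cover of ΩΩI₀ used in the transpose an isomorphism.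
  have := projective_syzygy_syzygy (k := k) hC I₀
  obtain ⟨Ψ, hΨs, hΨ, hΨ0⟩ := exists_surjective_ext_two (k := k) _ c₀.2.1 _ c₁.2.1
    (LinearEquiv.ofBijective _
      (projCover k Cᵐᵒᵖ (syzygy k Cᵐᵒᵖ (syzygy k Cᵐᵒᵖ I₀))).isCover.bijective)
  refine hμ.eq_zero_of_surjective hI g hg _ Ψ hΨs hΨ ?_ hM m e
  rintro _ ⟨θ, rfl⟩
  exact hΨ0 θ

end InjectiveEnvelope

/-! ### Part (a): Ext²(DC, P₀) and τ⁻¹Ω⁻¹P₀ -/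

section ProjectiveCover

open Abelian

variable {k C : Type u} [Field k] [Ring C] [Algebra k C]

/-- If the projective module `P₀` maps onto `M`, and there is no nonzero map to `M` from a quotient
`V / W` that maps onto `Ext²(D C, P₀)`, then `Hom_C(M ⊗_C E, M) = 0`. -/
theorem IsTensorHom.eq_zero_of_surjective_ext_dual
    {M : Type u} [AddCommGroup M] [Module Cᵐᵒᵖ M]
    {P₀ : Type u} [AddCommGroup P₀] [Module Cᵐᵒᵖ P₀] [Module.Finite Cᵐᵒᵖ P₀]
    [Module.Projective Cᵐᵒᵖ P₀] (f : P₀ →ₗ[Cᵐᵒᵖ] M) (hf : Function.Surjective f)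
    {V : Type u} [AddCommGroup V] [Module Cᵐᵒᵖ V] (W : Submodule Cᵐᵒᵖ V)
    (Ψ : V →+ Ext.{u} (ModuleCat.of Cᵐᵒᵖ (D k C)) (ModuleCat.of Cᵐᵒᵖ P₀) 2)
    (hΨs : Function.Surjective Ψ)
    (hΨ : ∀ (a : C) v, Ψ (op a • v) = (Ext.mk₀ (dualLeftHom k a)).comp (Ψ v) (zero_add 2))
    (hW : ∀ w ∈ W, Ψ w = 0) (hM : ∀ h : V ⧸ W →ₗ[Cᵐᵒᵖ] M, h = 0)
    {μ : M →+ RelBimodule k C →+ M} (hμ : IsTensorHom μ) (m : M) (e : RelBimodule k C) :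
    μ m e = 0 := by
  obtain ⟨n, x, φ, hx⟩ := exists_dualBasis_right C P₀
  let ρ : Fin n → Ext.{u} (ModuleCat.of Cᵐᵒᵖ (D k C)) (ModuleCat.of Cᵐᵒᵖ P₀) 2 →+
      RelBimodule k C := fun i => (Ext.mk₀ (ModuleCat.ofHom (φ i))).postcomp _ (add_zero 2)
  have hρ : ∀ i ξ, ρ i ξ = ξ.comp (Ext.mk₀ (ModuleCat.ofHom (φ i))) (add_zero 2) :=
    fun _ _ => rfl
  -- The composite V → Ext²(DC, P₀) ≅ P₀ ⊗ E → M ⊗ E → M, written in the dual basis of P₀.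
  let h : V →ₗ[Cᵐᵒᵖ] M :=
    { toFun := fun v => ∑ i, μ (f (x i)) (ρ i (Ψ v))
      map_add' := fun v v' => by simp only [map_add, Finset.sum_add_distrib]
      map_smul' := fun a v => by
        rw [RingHom.id_apply, Finset.smul_sum]
        refine Finset.sum_congr rfl fun i _ => ?_
        rw [← op_unop a, ← hμ.2, hΨ]
        congr 1
        exact Ext.comp_assoc_of_third_deg_zero _ _ _ _ }
  have h0 : ∀ ξ, ∑ i, μ (f (x i)) (ρ i ξ) = 0 := fun ξ => by
    obtain ⟨v, rfl⟩ := hΨs ξ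
    have hle : W ≤ LinearMap.ker h := fun w hw => by
      change ∑ i, μ (f (x i)) (ρ i (Ψ w)) = 0
      rw [hW w hw]
      simp
    exact LinearMap.congr_fun (hM (W.liftQ h hle)) (W.mkQ v)
  obtain ⟨p, rfl⟩ := hf m
  -- Pushing e forward along c ↦ p c gives the class of p ⊗ e; its i-th coordinate is φᵢ(p) e, and ∑
  -- xᵢ φᵢ(p) = p.
  let l : C →ₗ[Cᵐᵒᵖ] P₀ :=
    { toFun := fun c => op c • p
      map_add' := fun c c' => by rw [MulOpposite.op_add, add_smul]
      map_smul' := fun a c => by rw [RingHom.id_apply, smul_smul]; rfl }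
  have hl : ∀ i, ModuleCat.ofHom (φ i ∘ₗ l) = mulLeftHom (φ i p) := fun i => by
    refine ModuleCat.hom_ext (LinearMap.ext fun c => ?_)
    change φ i (op c • p) = φ i p * c
    rw [map_smul]; rfl
  rw [← h0 (e.toExt.comp (Ext.mk₀ (ModuleCat.ofHom l)) (add_zero 2))]
  have h1 : ∀ i, ρ i (e.toExt.comp (Ext.mk₀ (ModuleCat.ofHom l)) (add_zero 2)) = φ i p • e := by
    intro i
    change _ = extLeft (φ i p) e.toExt
    rw [hρ, Ext.comp_assoc_of_second_deg_zero, Ext.mk₀_comp_mk₀, extLeft, ← hl]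
    rfl
  simp only [h1, ← hμ.1]
  conv_lhs => rw [← hx p, map_sum, map_sum, AddMonoidHom.finsetSum_apply]
  simp only [map_smul]

variable {P₀ I X P : Type u} [AddCommGroup P₀] [Module Cᵐᵒᵖ P₀]
  [AddCommGroup I] [Module Cᵐᵒᵖ I]
  [AddCommGroup X] [Module k X] [Module Cᵐᵒᵖ X] [IsScalarTower k Cᵐᵒᵖ X]
  [AddCommGroup P] [Module k P] [Module C P] [IsScalarTower k C P]

/-- The dual of the exact sequence `ker p → P → D X`. -/
theorem shortExact_transpose [FiniteDimensional k X] (p : P →ₗ[C] D k X)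
    (hp : Function.Surjective p) :
    (ShortComplex.mk (ModuleCat.ofHom (transpose p))
      (ModuleCat.ofHom (dualMap (k := k) (LinearMap.ker p).subtype))
      (by
        refine ModuleCat.hom_ext (LinearMap.ext fun x => D.ext fun y => ?_)
        change p y.1 x = 0
        rw [y.2]; rfl)).ShortExact where
  exact := by
    refine (ShortComplex.ShortExact.moduleCat_exact_iff_function_exact _).mpr fun ψ => ⟨?_, ?_⟩
    · intro hψ
      have hψ0 : ∀ y, p y = 0 → ψ y = 0 := fun y hy =>
        congrArg (fun χ : D k (LinearMap.ker p) => χ ⟨y, hy⟩) hψ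
      have hpk : ∀ (a : k) y, p (a • y) = a • p y := fun a y => by
        rw [← algebraMap_smul C a y, map_smul, algebraMap_smul]
      let pk : P →ₗ[k] D k X := { toFun := p, map_add' := map_add p, map_smul' := hpk }
      -- A functional vanishing on ker p factors through DX, and by reflexivity it is evaluation at
      -- an element of X.
      obtain ⟨θ, hθ⟩ := exists_comp_eq_of_ker_le pk (show P →ₗ[k] k from ψ) hp hψ0
      refine ⟨(Module.evalEquiv k X).symm θ, D.ext fun y => ?_⟩
      change p y ((Module.evalEquiv k X).symm θ) = _
      refine Eq.trans ?_ (hθ y)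
      exact LinearMap.congr_fun ((Module.evalEquiv k X).apply_symm_apply θ) (p y)
    · rintro ⟨x, rfl⟩
      refine D.ext fun y => ?_
      change p y.1 x = 0
      rw [y.2]; rfl
  mono_f := by
    refine (ModuleCat.mono_iff_injective _).mpr fun x x' h => ?_
    refine D.eq_of_forall_apply_eq (k := k) fun ψ => ?_
    obtain ⟨y, rfl⟩ := hp ψ
    exact congrArg (fun χ : D k P => χ y) h
  epi_g := by
    refine (ModuleCat.epi_iff_surjective _).mpr fun ψ => ?_
    obtain ⟨ψ', h⟩ := D.exists_extend ((LinearMap.ker p).subtype.restrictScalars k)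
      (LinearMap.ker p).injective_subtype ψ
    exact ⟨ψ', D.ext h⟩

/-- An injective map and its cokernel form a short exact sequence. -/
theorem shortExact_mkQ_range {S U V : Type u} [Ring S] [AddCommGroup U] [Module S U]
    [AddCommGroup V] [Module S V] (j : U →ₗ[S] V) (hj : Function.Injective j) :
    (ShortComplex.mk (ModuleCat.ofHom j) (ModuleCat.ofHom (LinearMap.range j).mkQ)
      (by
        refine ModuleCat.hom_ext (LinearMap.ext fun x => ?_)
        exact (Submodule.Quotient.mk_eq_zero _).mpr ⟨x, rfl⟩)).ShortExact where
  exact := (ShortComplex.ShortExact.moduleCat_exact_iff_function_exact _).mpr fun _ =>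
    Submodule.Quotient.mk_eq_zero _
  mono_f := (ModuleCat.mono_iff_injective _).mpr hj
  epi_g := (ModuleCat.epi_iff_surjective _).mpr (Submodule.mkQ_surjective _)

/-- A module `Q` with `Ext¹(Z, Q) = 0` for all finitely generated modules `Z` is injective. -/
theorem injective_of_ext_one_eq_zero {S Q : Type u} [Ring S] [AddCommGroup Q] [Module S Q]
    (h : ∀ Z : ModuleCat.{u} S, Module.Finite S Z →
      ∀ η : Ext.{u} Z (ModuleCat.of S Q) 1, η = 0) : Module.Injective S Q := by
  -- Baer's criterion tests only ideal inclusions, whose cokernels S / J are cyclic.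
  refine Module.Baer.injective fun J g => ?_
  have hS := shortExact_mkQ_range J.subtype J.injective_subtype
  obtain ⟨ζ, hζ⟩ := Ext.contravariant_sequence_exact₁ hS (ModuleCat.of S Q)
    (Ext.mk₀ (ModuleCat.ofHom g)) (show 1 + 0 = 1 from rfl) (h _ (by dsimp; infer_instance) _)
  obtain ⟨t, rfl⟩ := Ext.addEquiv₀.symm.surjective ζ
  have ht : ModuleCat.ofHom J.subtype ≫ t = ModuleCat.ofHom g := by
    apply Ext.addEquiv₀.symm.injective
    exact (Ext.mk₀_comp_mk₀ _ _).symm.trans hζ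
  exact ⟨t.hom, fun x hx => LinearMap.congr_fun (congrArg ModuleCat.Hom.hom ht) ⟨x, hx⟩⟩

variable [FiniteDimensional k C]

/-- In global dimension at most two, the syzygy of the dual of the first cosyzygy is projective. -/
theorem projective_ker_of_cosyzygy (hC : GlobalDimLE C 2) [Module.Finite C P]
    [Module.Projective C P] (hI : Module.Injective Cᵐᵒᵖ I)
    (j : P₀ →ₗ[Cᵐᵒᵖ] I) (hj : Function.Injective j)
    [Module k (I ⧸ LinearMap.range j)] [IsScalarTower k Cᵐᵒᵖ (I ⧸ LinearMap.range j)]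
    [FiniteDimensional k (I ⧸ LinearMap.range j)]
    (p : P →ₗ[C] D k (I ⧸ LinearMap.range j)) (hp : Function.Surjective p) :
    Module.Projective C (LinearMap.ker p) := by
  have : IsArtinianRing C := IsArtinianRing.of_finite k C
  -- The global dimension bound concerns right modules while ker p is a left module, so its dual is
  -- shown to be injective: Ext¹(Z, D ker p) embeds into Ext³(Z, P₀) = 0 along P₀ → I → DP → D ker
  -- p.
  refine projective_of_injective_dual (k := k) (injective_of_ext_one_eq_zero fun Z hZ η => ?_)
  have i₀ := (Module.injective_iff_injective_object Cᵐᵒᵖ I).mp hI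
  have i₁ := (Module.injective_iff_injective_object Cᵐᵒᵖ (D k P)).mp injective_dual_of_projective
  have : HasProjectiveDimensionLT Z 3 := hC Z hZ
  exact ext_one_eq_zero (shortExact_mkQ_range j hj) (shortExact_transpose p hp) η

/-- The second extension group as a quotient of the dual of a projective syzygy. -/
theorem exists_surjective_ext_two_dual {P₂ : Type u} [AddCommGroup P₂] [Module C P₂]
    [Module.Projective C P] (hI : Module.Injective Cᵐᵒᵖ I)
    (j : P₀ →ₗ[Cᵐᵒᵖ] I) (hj : Function.Injective j)
    [Module k (I ⧸ LinearMap.range j)] [IsScalarTower k Cᵐᵒᵖ (I ⧸ LinearMap.range j)]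
    [FiniteDimensional k (I ⧸ LinearMap.range j)]
    (p : P →ₗ[C] D k (I ⧸ LinearMap.range j)) (hp : Function.Surjective p)
    (q : P₂ ≃ₗ[C] LinearMap.ker p) :
    ∃ Ψ : (P₂ →ₗ[C] C) →+ Ext.{u} (ModuleCat.of Cᵐᵒᵖ (D k C)) (ModuleCat.of Cᵐᵒᵖ P₀) 2,
      Function.Surjective Ψ ∧
      (∀ (a : C) φ, Ψ (op a • φ) = (Ext.mk₀ (dualLeftHom k a)).comp (Ψ φ) (zero_add 2)) ∧
      ∀ θ : P →ₗ[C] C, Ψ (θ ∘ₗ (LinearMap.ker p).subtype ∘ₗ q.toLinearMap) = 0 := by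
  have i₀ := (Module.injective_iff_injective_object Cᵐᵒᵖ I).mp hI
  have i₁ := (Module.injective_iff_injective_object Cᵐᵒᵖ (D k P)).mp injective_dual_of_projective
  have s₀ := shortExact_mkQ_range j hj
  have s₁ := shortExact_transpose p hp
  let δ : Ext.{u} (ModuleCat.of Cᵐᵒᵖ (D k (LinearMap.ker p))) (ModuleCat.of Cᵐᵒᵖ P₀) 2 :=
    spliceClass s₀ s₁
  -- By duality Hom(P₂, C) is identified with Hom(DC, D ker p), which acts on the splice class by
  -- pullback.
  let d : (P₂ →ₗ[C] C) → (ModuleCat.of Cᵐᵒᵖ (D k C) ⟶ ModuleCat.of Cᵐᵒᵖ (D k (LinearMap.ker p))) :=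
    fun φ => ModuleCat.ofHom (dualMap (φ ∘ₗ q.symm.toLinearMap))
  refine ⟨AddMonoidHom.mk' (fun φ => (Ext.mk₀ (d φ)).comp δ (zero_add 2)) fun φ φ' => ?_,
    fun ξ => ?_, fun a φ => ?_, fun θ => ?_⟩
  · rw [← Ext.add_comp, ← Ext.mk₀_add]
    congr 2
    refine ModuleCat.hom_ext (LinearMap.ext fun ψ => D.ext fun x => ?_)
    exact map_add ψ _ _
  · obtain ⟨v, hv⟩ := comp_spliceClass_surjective s₀ s₁ ξ
    obtain ⟨φ, hφ⟩ := exists_eq_dual v.hom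
    refine ⟨φ ∘ₗ q.toLinearMap, ?_⟩
    rw [← hv]
    change (Ext.mk₀ (d _)).comp δ (zero_add 2) = (Ext.mk₀ _).comp δ (zero_add 2)
    congr 2
    refine ModuleCat.hom_ext (LinearMap.ext fun ψ => D.ext fun x => ?_)
    change ψ (φ (q (q.symm x))) = _
    rw [q.apply_symm_apply]
    exact (hφ ψ x).symm
  · change (Ext.mk₀ (d _)).comp δ (zero_add 2) =
      (Ext.mk₀ _).comp ((Ext.mk₀ (d _)).comp δ (zero_add 2)) (zero_add 2)
    rw [Ext.mk₀_comp_mk₀_assoc]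
    rfl
  · refine Eq.trans ?_ (comp_spliceClass_eq_zero s₀ s₁ (ModuleCat.ofHom (dualMap θ)))
    change (Ext.mk₀ (d _)).comp δ (zero_add 2) = (Ext.mk₀ _).comp δ (zero_add 2)
    congr 2
    refine ModuleCat.hom_ext (LinearMap.ext fun ψ => D.ext fun x => ?_)
    change ψ (θ ((q (q.symm x)).1)) = _
    rw [q.apply_symm_apply]; rfl

/-- If `P₀` is projective and maps onto `M`, and `Hom_C(τ⁻¹ Ω⁻¹ P₀, M) = 0`, then
`Hom_C(M ⊗_C E, M) = 0`. -/
theorem IsTensorHom.eq_zero_of_tauInv_cosyzygy_hom (hC : GlobalDimLE C 2)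
    {M : Type u} [AddCommGroup M] [Module Cᵐᵒᵖ M]
    [Module k P₀] [IsScalarTower k Cᵐᵒᵖ P₀] [Module.Finite Cᵐᵒᵖ P₀] [Module.Projective Cᵐᵒᵖ P₀]
    (f : P₀ →ₗ[Cᵐᵒᵖ] M) (hf : Function.Surjective f)
    (hM : ∀ h : tauInv k C (cosyzygy k Cᵐᵒᵖ P₀) →ₗ[Cᵐᵒᵖ] M, h = 0)
    {μ : M →+ RelBimodule k C →+ M} (hμ : IsTensorHom μ) (m : M) (e : RelBimodule k C) :
    μ m e = 0 := by
  obtain ⟨hI, hj, -⟩ := (injEnv k Cᵐᵒᵖ P₀).isEnvelope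
  have c₀ := (projCover k C (D k (cosyzygy k Cᵐᵒᵖ P₀))).isCover
  have := c₀.1
  have : FiniteDimensional k (cosyzygy k Cᵐᵒᵖ P₀) := Module.Finite.trans Cᵐᵒᵖ _
  let _ : Module k (projCover k C (D k (cosyzygy k Cᵐᵒᵖ P₀))).P :=
    Module.compHom _ (algebraMap k C)
  have _ : IsScalarTower k C (projCover k C (D k (cosyzygy k Cᵐᵒᵖ P₀))).P := ⟨fun a s x => by
    rw [Algebra.smul_def, mul_smul]; rfl⟩
  have := projective_ker_of_cosyzygy hC hI _ hj _ c₀.2.1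
  obtain ⟨Ψ, hΨs, hΨ, hΨ0⟩ := exists_surjective_ext_two_dual hI _ hj _ c₀.2.1
    (LinearEquiv.ofBijective _
      (projCover k C (syzygy k C (D k (cosyzygy k Cᵐᵒᵖ P₀)))).isCover.bijective)
  refine hμ.eq_zero_of_surjective_ext_dual f hf _ Ψ hΨs hΨ ?_ hM m e
  rintro _ ⟨θ, rfl⟩
  exact hΨ0 θ

end ProjectiveCover

end ArtinAlg

theorem proposition4p6 {k C : Type u} [Field k] [IsAlgClosed k] [Ring C] [Algebra k C]
    [FiniteDimensional k C] (hC : ArtinAlg.GlobalDimLE C 2)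
    {M : Type u} [AddCommGroup M] [Module Cᵐᵒᵖ M] [Module.Finite Cᵐᵒᵖ M]
    (hss : IsSemisimpleModule Cᵐᵒᵖ M) (hM : ArtinAlg.IsTauRigid k C M)
    {P₀ : Type u} [AddCommGroup P₀] [Module k P₀] [Module Cᵐᵒᵖ P₀] [IsScalarTower k Cᵐᵒᵖ P₀]
    [Module.Finite Cᵐᵒᵖ P₀] (f : P₀ →ₗ[Cᵐᵒᵖ] M) (hf : ArtinAlg.IsProjectiveCover f)
    {I₀ : Type u} [AddCommGroup I₀] [Module Cᵐᵒᵖ I₀] [Module.Finite Cᵐᵒᵖ I₀]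
    (g : M →ₗ[Cᵐᵒᵖ] I₀) (hg : ArtinAlg.IsInjectiveEnvelope g) :
    ((∀ h : ArtinAlg.tauInv k C (ArtinAlg.cosyzygy k Cᵐᵒᵖ P₀) →ₗ[Cᵐᵒᵖ] M, h = 0) →
      ArtinAlg.IsTauRigid k (ArtinAlg.RelExt k C) (ArtinAlg.Inflation k C M)) ∧
    ((∀ h : M →ₗ[Cᵐᵒᵖ] ArtinAlg.tau k C (ArtinAlg.syzygy k Cᵐᵒᵖ I₀), h = 0) →
      ArtinAlg.IsTauRigid k (ArtinAlg.RelExt k C) (ArtinAlg.Inflation k C M)) := by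
  have := hf.1
  exact ⟨fun h => ArtinAlg.isTauRigid_inflation hM fun _ hμ =>
      hμ.eq_zero_of_tauInv_cosyzygy_hom hC f hf.2.1 h,
    fun h => ArtinAlg.isTauRigid_inflation hM fun _ hμ =>
      hμ.eq_zero_of_hom_tau_syzygy hC hg.1 g hg.2.1 h⟩
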